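/- Let $W=(W(t,A))$, indexed by $t\ge 0$ and bounded Borel sets $A\subset\mathbb R$, be a space-time white noise on a probability space $(\Omega,\mathcal F,\mathbb P)$, i.e. a centred Gaussian process with $\mathbb E[W(t,A)W(t',A')]=(t\wedge t')\,\lambda(A\cap A')$, where $\lambda$ is Lebesgue measure. Let $G(t,x)=(2\pi t)^{-1/2}e^{-x^2/(2t)}$ for $t>0$ and $G(t,x)=0$ for $t\le 0$, and let $$u(t,x)=\int_0^t\int_{\mathbb R}G(t-s,x-y)\,dW(s,y),\qquad t\ge 0,\ x\in\mathbb R,$$ (a Wiener integral, for each $(t,x)$ defined up to a null event) be the mild solution of $\partial_t u=\tfrac12\Delta u+\frac{\partial^2}{\partial t\partial x}W$, $u(0,\cdot)=0$. Fix $T>0$ and $x\in\mathbb R$, and let $t\mapsto u(t,x)$, $t\in[0,T]$, be taken in a version for which $(\omega,t)\mapsto u(t,x)(\omega)$ is measurable with respect to the $\mathbb P\otimes\lambda|_{[0,T]}$-completion (for instance, an almost surely continuous version). Then $(u(t,x),\ t\in[0,T])$ has almost surely a jointly continuous local time: there are random variables $L(\xi,t)$, $\xi\in\mathbb R$, $t\in[0,T]$,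 such that almost surely $(\xi,t)\mapsto L(\xi,t)$ is continuous on $\mathbb R\times[0,T]$ and, for every $t\in[0,T]$, the occupation measure $A\mapsto\lambda\{s\in[0,t]: u(s,x)\in A\}$ is absolutely continuous with respect to $\lambda$ with Radon–Nikodym derivative $L(\cdot,t)$. Moreover, for every $\alpha<3/4$ there are random variables $\eta,\eta'$, almost surely positive and finite, such that almost surely $$\sup_{\xi\in\mathbb R}|L(\xi,t+h)-L(\xi,t)|\le \eta'\,|h|^{\alpha}\qquad\text{for all } t,\,t+h\in[0,T]\text{ with }|h|<\eta .$$ -/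

import Mathlib

open MeasureTheory ProbabilityTheory Set
open scoped NNReal ENNReal

noncomputable section

/-- The bounded Borel subsets of the real line. -/
abbrev BoundedBorel : Type :=
  {A : Set ℝ // MeasurableSet A ∧ Bornology.IsBounded A}

/-- `W t A`, for `t ≥ 0` and `A` a bounded Borel set, is a space-time white noise on `ℝ₊ × ℝ`:
a centred Gaussian process with covariance `E[W(t,A) W(t',A')] = (t ∧ t') λ(A ∩ A')`. -/
structure IsWhiteNoise {Ω : Type*} [MeasurableSpace Ω] (P : Measure Ω)
    (W : ℝ≥0 → BoundedBorel → Ω → ℝ) : Prop where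
  gaussian : IsGaussianProcess (fun p : ℝ≥0 × BoundedBorel => W p.1 p.2) P
  centered : ∀ t A, ∫ ω, W t A ω ∂P = 0
  covariance : ∀ t t' A A', ∫ ω, W t A ω * W t' A' ω ∂P =
    ((min t t' : ℝ≥0) : ℝ) * (volume ((A : Set ℝ) ∩ (A' : Set ℝ))).toReal

/-- The step function `∑ i, c i • 1_{(a i, b i] × A i}` of (time, space). -/
def stepFun {n : ℕ} (c : Fin n → ℝ) (a b : Fin n → ℝ≥0) (A : Fin n → BoundedBorel) :
    ℝ × ℝ → ℝ :=
  fun p => ∑ i, (Ioc (a i : ℝ) (b i : ℝ) ×ˢ (A i : Set ℝ)).indicator (fun _ => c i) p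

/-- The integral of that step function against `W`:
`∑ i, c i (W(b i, A i) - W(a i, A i))`. -/
def stepIntegral {Ω : Type*} (W : ℝ≥0 → BoundedBorel → Ω → ℝ) {n : ℕ}
    (c : Fin n → ℝ) (a b : Fin n → ℝ≥0) (A : Fin n → BoundedBorel) : Ω → ℝ :=
  fun ω => ∑ i, c i * (W (b i) (A i) ω - W (a i) (A i) ω)

/-- Lebesgue measure on `ℝ₊ × ℝ` (time in the first coordinate), as a measure on `ℝ × ℝ`. -/
def halfPlaneVolume : Measure (ℝ × ℝ) :=
  (volume : Measure (ℝ × ℝ)).restrict (Ici (0 : ℝ) ×ˢ (univ : Set ℝ))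

/-- `X` is (a version of) the Wiener integral `∫_0^∞ ∫_ℝ f(s,y) dW(s,y)` of
`f ∈ L²(ℝ₊ × ℝ)`: the limit in `L²(P)` of integrals of step functions
that converge to `f` in `L²(ℝ₊ × ℝ)`. -/
def IsWienerIntegral {Ω : Type*} [MeasurableSpace Ω] (P : Measure Ω)
    (W : ℝ≥0 → BoundedBorel → Ω → ℝ) (f : ℝ × ℝ → ℝ) (X : Ω → ℝ) : Prop :=
  MemLp f 2 halfPlaneVolume ∧ MemLp X 2 P ∧
    ∀ ε : ℝ≥0∞, 0 < ε →
      ∃ (n : ℕ) (c : Fin n → ℝ) (a b : Fin n → ℝ≥0) (A : Fin n → BoundedBorel),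
        (∀ i, a i ≤ b i) ∧
        eLpNorm (fun p => f p - stepFun c a b A p) 2 halfPlaneVolume < ε ∧
        eLpNorm (fun ω => X ω - stepIntegral W c a b A ω) 2 P < ε

/-- The Green kernel of `∂_t - ½ Δ` on the real line, zero for `t ≤ 0`. -/
def heatKernel (t x : ℝ) : ℝ :=
  if 0 < t then (Real.sqrt (2 * Real.pi * t))⁻¹ * Real.exp (-(x ^ 2) / (2 * t)) else 0

/-- `u` is the mild solution of `∂_t u = ½ Δ u + ∂²W/∂t∂x`, `u(0,·) = 0`: for all `t ≥ 0` and
`x`, `u(t,x) = ∫_0^t ∫_ℝ G(t-s, x-y) dW(s,y)` almost surely. The kernel vanishes for `s ≥ t`, so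
the integral over `[0,t]` is the one over `ℝ₊`. -/
def IsMildSolution {Ω : Type*} [MeasurableSpace Ω] (P : Measure Ω)
    (W : ℝ≥0 → BoundedBorel → Ω → ℝ) (u : ℝ → ℝ → Ω → ℝ) : Prop :=
  ∀ t : ℝ, 0 ≤ t → ∀ x : ℝ,
    IsWienerIntegral P W (fun p => heatKernel (t - p.1) (x - p.2)) (u t x)

/-- The occupation measure `A ↦ λ{s ∈ B : θ s ∈ A}`. -/
def occupationMeasure (θ : ℝ → ℝ) (B : Set ℝ) : Measure ℝ :=
  (volume.restrict B).map θ

/-- `ℓ` is (a version of) the local time of `θ` on `B`: the occupation measure is absolutely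
continuous and `ℓ` is its Radon–Nikodym derivative. Measurability of `θ` on `B` is required, as the
occupation measure has no meaning without it. -/
def IsLocalTime (θ : ℝ → ℝ) (B : Set ℝ) (ℓ : ℝ → ℝ) : Prop :=
  AEMeasurable θ (volume.restrict B) ∧
    occupationMeasure θ B ≪ volume ∧
    ∀ᵐ ξ : ℝ, ℓ ξ = ((occupationMeasure θ B).rnDeriv volume ξ).toReal

end

/-! ### White noise: step integrals, the Itô isometry, independence of the past -/

section WhiteNoise

variable {Ω : Type*} [MeasurableSpace Ω] {P : Measure Ω}
  {W : ℝ≥0 → BoundedBorel → Ω → ℝ}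

/-! The occupation measure of a path f on (s, t] has the Fourier transform F(θ) = ∫_s^t exp(-2πiθ
f(q)) dq, which is `pathFourier`. Once F is integrable in θ, Fourier inversion gives a continuous
density, and the increment of the local time between s and t is bounded, uniformly in ξ, by the L¹
norm of F, which is `pathFourierNorm`. It therefore suffices to bound this norm almost surely by a
multiple of |t-s|^α for α < 3/4. Path continuity plays no role.

The probabilistic input is one-sided local nondeterminism. The noise after time r is independent of
the noise before it, and it contributes at least √(s-r)/(2√π) to the variance of u(s,x). Hence, for
bounded V depending on the noise up to r, |E[V exp(iθu(s,x))]| ≤ exp(-cθ²√(s-r)) E|V| with c =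
1/(4√π). The exponential is at most K(1+θ²)^(-2γ)(s-r)^(-γ), which is integrable in r when γ < 1.

Let B be the running integral of g, a cosine of the path. Then B^(2n+2) is (2n+2)(2n+1) times the
integral over r < s of B_r^(2n) g_r g_s. The decay at the last time s and induction on n
(`integral_runningIntegral_pow_le`) give E|F(θ)|^(2n) ≤ D(1+θ²)^(-2γn)(t-s)^(n(2-γ)).

When γ > 1/2 the weight (1+θ²)^(-γ) is integrable, and a weighted Jensen inequality carries the
bound over to the 2n-th moment of the L¹ norm. The order in time is 1-γ/2, which tends to 3/4 as γ
decreases to 1/2. Kolmogorov's criterion with n large (`exists_holder_of_moment`), applied to the L¹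
norm as a random pseudodistance in (s,t), concludes. -/

lemma halfPlaneVolume_real_prod {a b : ℝ} (ha : 0 ≤ a) {A : Set ℝ} :
    halfPlaneVolume.real (Ioc a b ×ˢ A) = max (b - a) 0 * volume.real A := by
  have h : Ioc a b ×ˢ A ∩ Ici (0 : ℝ) ×ˢ (univ : Set ℝ) = Ioc a b ×ˢ A := by
    refine inter_eq_left.2 (prod_mono (fun s hs => ?_) (subset_univ _))
    exact ha.trans hs.1.le
  rw [Measure.real, halfPlaneVolume, Measure.restrict_apply' (measurableSet_Ici.prod .univ), h,
    Measure.volume_eq_prod, Measure.prod_prod, ENNReal.toReal_mul, Real.volume_Ioc,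
    ENNReal.toReal_ofReal', Measure.real]

lemma IsWhiteNoise.memLp (hW : IsWhiteNoise P W) (t : ℝ≥0) (A : BoundedBorel) :
    MemLp (W t A) 2 P :=
  (hW.gaussian.hasGaussianLaw_eval (t, A)).memLp_two

lemma IsWhiteNoise.integrable_mul (hW : IsWhiteNoise P W) (t t' : ℝ≥0) (A A' : BoundedBorel) :
    Integrable (fun ω => W t A ω * W t' A' ω) P :=
  (hW.memLp t A).integrable_mul (hW.memLp t' A')

lemma IsWhiteNoise.memLp_stepIntegral (hW : IsWhiteNoise P W) {n : ℕ} (c : Fin n → ℝ)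
    (a b : Fin n → ℝ≥0) (A : Fin n → BoundedBorel) :
    MemLp (stepIntegral W c a b A) 2 P :=
  memLp_finsetSum _ fun i _ => ((hW.memLp (b i) (A i)).sub (hW.memLp (a i) (A i))).const_mul (c i)

lemma IsWhiteNoise.integral_increment_mul (hW : IsWhiteNoise P W) {a b a' b' : ℝ≥0}
    (hab : a ≤ b) (hab' : a' ≤ b') (A A' : BoundedBorel) :
    ∫ ω, (W b A ω - W a A ω) * (W b' A' ω - W a' A' ω) ∂P =
      halfPlaneVolume.real ((Ioc (a : ℝ) b ×ˢ (A : Set ℝ)) ∩ (Ioc (a' : ℝ) b' ×ˢ (A' : Set ℝ))) := by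
  have h1 : ∀ ω, (W b A ω - W a A ω) * (W b' A' ω - W a' A' ω) =
      (W b A ω * W b' A' ω - W b A ω * W a' A' ω) -
        (W a A ω * W b' A' ω - W a A ω * W a' A' ω) := fun ω => by ring
  simp_rw [h1]
  rw [integral_sub, integral_sub, integral_sub, hW.covariance, hW.covariance, hW.covariance,
    hW.covariance, prod_inter_prod, Ioc_inter_Ioc, halfPlaneVolume_real_prod (by positivity)]
  -- The length of the intersection of two time intervals is the mixed second difference of `min`.
  · simp only [Measure.real, NNReal.coe_min]
    rw [← sub_mul, ← sub_mul, ← sub_mul]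
    congr 1
    have h2 : (a : ℝ) ≤ b := hab
    have h3 : (a' : ℝ) ≤ b' := hab'
    grind
  all_goals first
    | exact hW.integrable_mul _ _ _ _
    | exact (hW.integrable_mul _ _ _ _).sub (hW.integrable_mul _ _ _ _)

lemma measurableSet_stepRect {n : ℕ} (a b : Fin n → ℝ≥0) (A : Fin n → BoundedBorel) (i : Fin n) :
    MeasurableSet (Ioc (a i : ℝ) (b i : ℝ) ×ˢ (A i : Set ℝ)) :=
  measurableSet_Ioc.prod (A i).2.1

lemma halfPlaneVolume_stepRect_lt_top {n : ℕ} (a b : Fin n → ℝ≥0) (A : Fin n → BoundedBorel)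
    (i : Fin n) : halfPlaneVolume (Ioc (a i : ℝ) (b i : ℝ) ×ˢ (A i : Set ℝ)) < ⊤ := by
  refine (Measure.restrict_apply_le _ _).trans_lt ?_
  rw [Measure.volume_eq_prod, Measure.prod_prod]
  exact ENNReal.mul_lt_top measure_Ioc_lt_top (A i).2.2.measure_lt_top

lemma memLp_stepFun {n : ℕ} (c : Fin n → ℝ) (a b : Fin n → ℝ≥0) (A : Fin n → BoundedBorel) :
    MemLp (stepFun c a b A) 2 halfPlaneVolume :=
  memLp_finsetSum _ fun i _ => memLp_indicator_const 2 (measurableSet_stepRect a b A i) (c i)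
    (Or.inr (halfPlaneVolume_stepRect_lt_top a b A i).ne)

/-- The Itô isometry for step functions. -/
lemma IsWhiteNoise.integral_stepIntegral_sq (hW : IsWhiteNoise P W) {n : ℕ} (c : Fin n → ℝ)
    (a b : Fin n → ℝ≥0) (A : Fin n → BoundedBorel) (hab : ∀ i, a i ≤ b i) :
    ∫ ω, stepIntegral W c a b A ω ^ 2 ∂P = ∫ p, stepFun c a b A p ^ 2 ∂halfPlaneVolume := by
  have hL : ∀ ω, stepIntegral W c a b A ω ^ 2 = ∑ i, ∑ j, c i * c j *
      ((W (b i) (A i) ω - W (a i) (A i) ω) * (W (b j) (A j) ω - W (a j) (A j) ω)) := by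
    intro ω
    rw [sq, stepIntegral, Finset.sum_mul_sum]
    exact Finset.sum_congr rfl fun i _ => Finset.sum_congr rfl fun j _ => by ring
  have hR : ∀ p, stepFun c a b A p ^ 2 = ∑ i, ∑ j, c i * c j *
      (((Ioc (a i : ℝ) (b i) ×ˢ (A i : Set ℝ)) ∩ (Ioc (a j : ℝ) (b j) ×ˢ (A j : Set ℝ))).indicator
        (fun _ => (1 : ℝ)) p) := by
    intro p
    rw [sq, stepFun, Finset.sum_mul_sum]
    refine Finset.sum_congr rfl fun i _ => Finset.sum_congr rfl fun j _ => ?_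
    rw [← inter_indicator_mul]
    by_cases h : p ∈ (Ioc (a i : ℝ) (b i) ×ˢ (A i : Set ℝ)) ∩ (Ioc (a j : ℝ) (b j) ×ˢ (A j : Set ℝ))
    · simp [indicator_of_mem h]
    · simp [indicator_of_notMem h]
  have hi : ∀ i j, Integrable (fun ω =>
      (W (b i) (A i) ω - W (a i) (A i) ω) * (W (b j) (A j) ω - W (a j) (A j) ω)) P := fun i j =>
    ((hW.memLp _ _).sub (hW.memLp _ _)).integrable_mul ((hW.memLp _ _).sub (hW.memLp _ _))
  have hm : ∀ i j, MeasurableSet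
      ((Ioc (a i : ℝ) (b i) ×ˢ (A i : Set ℝ)) ∩ (Ioc (a j : ℝ) (b j) ×ˢ (A j : Set ℝ))) :=
    fun i j => (measurableSet_stepRect a b A i).inter (measurableSet_stepRect a b A j)
  have hi' : ∀ i j, Integrable (((Ioc (a i : ℝ) (b i) ×ˢ (A i : Set ℝ)) ∩
      (Ioc (a j : ℝ) (b j) ×ˢ (A j : Set ℝ))).indicator fun _ => (1 : ℝ)) halfPlaneVolume :=
    fun i j => (integrable_indicator_iff (hm i j)).2 (integrableOn_const
      ((measure_mono inter_subset_left).trans_lt (halfPlaneVolume_stepRect_lt_top a b A i)).ne)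
  simp_rw [hL, hR]
  rw [integral_finsetSum _ fun i _ => integrable_finsetSum _ fun j _ => (hi i j).const_mul _,
    integral_finsetSum _ fun i _ => integrable_finsetSum _ fun j _ => (hi' i j).const_mul _]
  refine Finset.sum_congr rfl fun i _ => ?_
  rw [integral_finsetSum _ fun j _ => (hi i j).const_mul _,
    integral_finsetSum _ fun j _ => (hi' i j).const_mul _]
  refine Finset.sum_congr rfl fun j _ => ?_
  rw [integral_const_mul, integral_const_mul, hW.integral_increment_mul (hab i) (hab j),
    integral_indicator_const _ (hm i j)]
  simp

/-- A step function restricted to times after `r`. -/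
lemma stepFun_max {n : ℕ} (c : Fin n → ℝ) (a b : Fin n → ℝ≥0) (A : Fin n → BoundedBorel)
    (r : ℝ≥0) :
    stepFun c (fun i => max (a i) r) (fun i => max (b i) r) A =
      (Ioi (r : ℝ) ×ˢ (univ : Set ℝ)).indicator (stepFun c a b A) := by
  ext p
  have h : ∀ i, (Ioc ((max (a i) r : ℝ≥0) : ℝ) ((max (b i) r : ℝ≥0) : ℝ) ×ˢ (A i : Set ℝ)) =
      (Ioi (r : ℝ) ×ˢ (univ : Set ℝ)) ∩ (Ioc (a i : ℝ) (b i : ℝ) ×ˢ (A i : Set ℝ)) := by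
    intro i
    ext ⟨s, y⟩
    simp only [NNReal.coe_max, mem_prod, mem_Ioc, mem_inter_iff, mem_Ioi, mem_univ, and_true]
    grind
  simp only [stepFun, h, ← indicator_indicator]
  by_cases hp : p ∈ (Ioi (r : ℝ) ×ˢ (univ : Set ℝ))
  · simp only [indicator_of_mem hp, stepFun]
  · simp only [indicator_of_notMem hp, Finset.sum_const_zero]

omit [MeasurableSpace Ω] in
-- Splits the noise at time r without refining any partition: W t is the sum of its values at min t
-- r and max t r minus W r, and the W r terms cancel in increments.
lemma stepIntegral_min_add_max {n : ℕ} (c : Fin n → ℝ) (a b : Fin n → ℝ≥0)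
    (A : Fin n → BoundedBorel) (r : ℝ≥0) (ω : Ω) :
    stepIntegral W c a b A ω =
      stepIntegral W c (fun i => min (a i) r) (fun i => min (b i) r) A ω +
      stepIntegral W c (fun i => max (a i) r) (fun i => max (b i) r) A ω := by
  have h : ∀ (t : ℝ≥0) (B : BoundedBorel), W t B ω = W (min t r) B ω + W (max t r) B ω - W r B ω := by
    intro t B
    rcases le_total t r with h | h <;> simp [h]
  simp only [stepIntegral, ← Finset.sum_add_distrib]
  refine Finset.sum_congr rfl fun i _ => ?_
  rw [h (b i), h (a i)]
  ring

/-- The σ-algebra generated by the noise up to time `r`. -/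
@[reducible]
def pastSigma (W : ℝ≥0 → BoundedBorel → Ω → ℝ) (r : ℝ≥0) : MeasurableSpace Ω :=
  MeasurableSpace.comap (fun ω (p : {p : ℝ≥0 × BoundedBorel // p.1 ≤ r}) => W p.1.1 p.1.2 ω)
    inferInstance

lemma pastSigma_le (hWm : ∀ t A, Measurable (W t A)) (r : ℝ≥0) :
    pastSigma W r ≤ ‹MeasurableSpace Ω› := by
  have h : Measurable (fun ω (p : {p : ℝ≥0 × BoundedBorel // p.1 ≤ r}) => W p.1.1 p.1.2 ω) :=
    measurable_pi_lambda _ fun p => hWm p.1.1 p.1.2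
  exact h.comap_le

omit [MeasurableSpace Ω] in
lemma measurable_pastSigma {r t : ℝ≥0} (ht : t ≤ r) (A : BoundedBorel) :
    Measurable[pastSigma W r] (W t A) := by
  have h : Measurable[pastSigma W r]
      (fun ω (p : {p : ℝ≥0 × BoundedBorel // p.1 ≤ r}) => W p.1.1 p.1.2 ω) := comap_measurable _
  exact (measurable_pi_apply (⟨(t, A), ht⟩ : {p : ℝ≥0 × BoundedBorel // p.1 ≤ r})).comp h

omit [MeasurableSpace Ω] in
lemma measurable_stepIntegral_pastSigma {n : ℕ} (c : Fin n → ℝ) {a b : Fin n → ℝ≥0}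
    (A : Fin n → BoundedBorel) {r : ℝ≥0} (ha : ∀ i, a i ≤ r) (hb : ∀ i, b i ≤ r) :
    Measurable[pastSigma W r] (stepIntegral W c a b A) :=
  @Finset.measurable_fun_sum _ _ _ _ _ _ (pastSigma W r) _ _ fun i _ =>
    ((measurable_pastSigma (hb i) (A i)).sub (measurable_pastSigma (ha i) (A i))).const_mul _

/-- Joint Gaussianity with the noise values is what turns vanishing covariance into independence. -/
lemma IsWhiteNoise.isGaussianProcess_stepIntegral (hW : IsWhiteNoise P W) {n : ℕ} (c : Fin n → ℝ)
    (a b : Fin n → ℝ≥0) (A : Fin n → BoundedBorel) {S : Type*} (f : S → ℝ≥0 × BoundedBorel) :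
    IsGaussianProcess (Sum.elim (fun s ω => W (f s).1 (f s).2 ω)
      (fun (_ : Unit) => stepIntegral W c a b A)) P := by
  classical
  refine hW.gaussian.of_isGaussianProcess fun s => ?_
  rcases s with s | s
  · exact ⟨{f s}, { toFun x := x ⟨f s, by simp⟩
                    map_add' := by simp
                    map_smul' := by simp }, by simp⟩
  · refine ⟨Finset.univ.image (fun i => (b i, A i)) ∪ Finset.univ.image (fun i => (a i, A i)),
      { toFun x := ∑ i, c i * (x ⟨(b i, A i), Finset.mem_union_left _ (Finset.mem_image_of_mem _ (Finset.mem_univ i))⟩ -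
          x ⟨(a i, A i), Finset.mem_union_right _ (Finset.mem_image_of_mem _ (Finset.mem_univ i))⟩)
        map_add' x y := by simp [← Finset.sum_add_distrib]; congr; ext; ring
        map_smul' m x := by simp [Finset.mul_sum]; congr; ext; ring }, ?_⟩
    intro ω
    simp [stepIntegral]

lemma IsWhiteNoise.hasGaussianLaw_stepIntegral (hW : IsWhiteNoise P W) {n : ℕ} (c : Fin n → ℝ)
    (a b : Fin n → ℝ≥0) (A : Fin n → BoundedBorel) :
    HasGaussianLaw (stepIntegral W c a b A) P :=
  (hW.isGaussianProcess_stepIntegral c a b A (S := Empty) Empty.elim).hasGaussianLaw_eval (.inr ())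

lemma IsWhiteNoise.integral_stepIntegral (hW : IsWhiteNoise P W) {n : ℕ} (c : Fin n → ℝ)
    (a b : Fin n → ℝ≥0) (A : Fin n → BoundedBorel) :
    ∫ ω, stepIntegral W c a b A ω ∂P = 0 := by
  have hi : ∀ t B, Integrable (W t B) P := fun t B =>
    (hW.gaussian.hasGaussianLaw_eval (t, B)).integrable
  simp only [stepIntegral]
  rw [integral_finsetSum _ fun i _ => Integrable.const_mul (by exact (hi _ _).sub (hi _ _)) _]
  refine Finset.sum_eq_zero fun i _ => ?_
  rw [integral_const_mul, integral_sub (hi _ _) (hi _ _), hW.centered, hW.centered]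
  simp

/-- A step integral over times after `r` is independent of the noise up to time `r`. -/
lemma IsWhiteNoise.indep_stepIntegral (hW : IsWhiteNoise P W) (hWm : ∀ t A, Measurable (W t A))
    {n : ℕ} (c : Fin n → ℝ) (a b : Fin n → ℝ≥0) (A : Fin n → BoundedBorel) {r : ℝ≥0}
    (ha : ∀ i, r ≤ a i) (hb : ∀ i, r ≤ b i) :
    Indep (pastSigma W r) (MeasurableSpace.comap (stepIntegral W c a b A) inferInstance) P := by
  have hP := hW.gaussian.isProbabilityMeasure
  have hS := hW.isGaussianProcess_stepIntegral c a b A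
    (fun p : {p : ℝ≥0 × BoundedBorel // p.1 ≤ r} => p.1)
  have hX : ∀ i t B, t ≤ r →
      ∫ ω, W t B ω * (W (b i) (A i) ω - W (a i) (A i) ω) ∂P = 0 := by
    intro i t B ht
    simp_rw [mul_sub]
    rw [integral_sub (hW.integrable_mul _ _ _ _) (hW.integrable_mul _ _ _ _), hW.covariance,
      hW.covariance, min_eq_left (ht.trans (ha i)), min_eq_left (ht.trans (hb i)), sub_self]
  have h := hS.indepFun_of_covariance_eq_zero (fun p => (hWm p.1.1 p.1.2).aemeasurable)
    (fun _ => (hW.memLp_stepIntegral c a b A).aestronglyMeasurable.aemeasurable) ?_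
  · have h2 := h.comp measurable_id (measurable_pi_apply ())
    exact h2
  · intro p _
    rw [covariance_eq_sub (hW.memLp _ _) (hW.memLp_stepIntegral c a b A), hW.centered,
      zero_mul, sub_zero]
    simp only [Pi.mul_apply, stepIntegral, Finset.mul_sum]
    rw [integral_finsetSum]
    · refine Finset.sum_eq_zero fun i _ => ?_
      have : ∀ ω, W p.1.1 p.1.2 ω * (c i * (W (b i) (A i) ω - W (a i) (A i) ω)) =
        c i * (W p.1.1 p.1.2 ω * (W (b i) (A i) ω - W (a i) (A i) ω)) := fun ω => by ring
      simp_rw [this]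
      rw [integral_const_mul, hX i _ _ p.2, mul_zero]
    · intro i _
      exact (hW.memLp _ _).integrable_mul (((hW.memLp _ _).sub (hW.memLp _ _)).const_mul (c i))

end WhiteNoise

/-! ### Wiener integrals: adaptedness and one-sided local nondeterminism -/

section WienerIntegral

lemma eLpNorm_two_eq_sqrt {α : Type*} [MeasurableSpace α] {μ : Measure α} {f : α → ℝ}
    (hf : MemLp f 2 μ) : eLpNorm f 2 μ = ENNReal.ofReal √(∫ x, f x ^ 2 ∂μ) := by
  rw [hf.eLpNorm_eq_integral_rpow_norm (by simp) (by simp), Real.sqrt_eq_rpow]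
  simp

variable {Ω : Type*} [MeasurableSpace Ω] {P : Measure Ω}
  {W : ℝ≥0 → BoundedBorel → Ω → ℝ}

lemma IsWhiteNoise.eLpNorm_stepIntegral (hW : IsWhiteNoise P W) {n : ℕ} (c : Fin n → ℝ)
    (a b : Fin n → ℝ≥0) (A : Fin n → BoundedBorel) (hab : ∀ i, a i ≤ b i) :
    eLpNorm (stepIntegral W c a b A) 2 P = eLpNorm (stepFun c a b A) 2 halfPlaneVolume := by
  rw [eLpNorm_two_eq_sqrt (hW.memLp_stepIntegral c a b A), eLpNorm_two_eq_sqrt (memLp_stepFun c a b A),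
    hW.integral_stepIntegral_sq c a b A hab]

/-- The integral of a function vanishing after time `r` is measurable with respect to the noise up
to time `r`. -/
lemma IsWienerIntegral.aestronglyMeasurable_pastSigma (hW : IsWhiteNoise P W)
    (hWm : ∀ t A, Measurable (W t A)) {f : ℝ × ℝ → ℝ} {X : Ω → ℝ} (hX : IsWienerIntegral P W f X)
    {r : ℝ≥0} (hf : ∀ p : ℝ × ℝ, (r : ℝ) < p.1 → f p = 0) :
    AEStronglyMeasurable[pastSigma W r] X P := by
  have hm := pastSigma_le hWm r
  -- The past-measurable classes are closed in L². Since f vanishes after r, the isometry bounds the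
  -- part Z of the step integral after r by the approximation error of f, so the part Y before r
  -- still approximates X.
  have key : hX.2.1.toLp X ∈ closure {g : Lp ℝ 2 P | AEStronglyMeasurable[pastSigma W r] g P} := by
    rw [EMetric.mem_closure_iff]
    intro ε hε
    obtain ⟨n, c, a, b, A, hab, h1, h2⟩ := hX.2.2 (ε / 2) (ENNReal.half_pos hε.ne')
    set Y := stepIntegral W c (fun i => min (a i) r) (fun i => min (b i) r) A
    set Z := stepIntegral W c (fun i => max (a i) r) (fun i => max (b i) r) A
    have hY : MemLp Y 2 P := hW.memLp_stepIntegral _ _ _ _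
    have hZ : MemLp Z 2 P := hW.memLp_stepIntegral _ _ _ _
    have hYm : StronglyMeasurable[pastSigma W r] Y :=
      (measurable_stepIntegral_pastSigma c A (fun i => min_le_right _ _)
        (fun i => min_le_right _ _)).stronglyMeasurable
    have hZn : eLpNorm Z 2 P < ε / 2 := by
      refine lt_of_le_of_lt ?_ h1
      rw [hW.eLpNorm_stepIntegral _ _ _ _ (fun i => max_le_max_right r (hab i)), stepFun_max]
      refine eLpNorm_mono fun p => ?_
      by_cases hp : p ∈ (Ioi (r : ℝ) ×ˢ (univ : Set ℝ))
      · rw [indicator_of_mem hp, hf p hp.1]; simp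
      · rw [indicator_of_notMem hp]; simp
    refine ⟨hY.toLp Y, ?_, ?_⟩
    · exact (hYm.aestronglyMeasurable).congr hY.coeFn_toLp.symm
    · rw [Lp.edist_toLp_toLp]
      have h3 : X - Y = (fun ω => X ω - stepIntegral W c a b A ω) + Z := by
        ext ω
        simp only [Pi.sub_apply, Pi.add_apply, stepIntegral_min_add_max c a b A r ω, Y, Z]
        ring
      rw [h3, ← ENNReal.add_halves ε]
      exact (eLpNorm_add_le (hX.2.1.sub (hW.memLp_stepIntegral c a b A)).1 hZ.1 (by simp)).trans_lt
        (ENNReal.add_lt_add h2 hZn)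
  rw [(isClosed_aestronglyMeasurable hm).closure_eq] at key
  exact AEStronglyMeasurable.congr key hX.2.1.coeFn_toLp

lemma integral_cexp_of_hasGaussianLaw {S : Ω → ℝ} (hS : HasGaussianLaw S P)
    (h0 : ∫ ω, S ω ∂P = 0) (θ : ℝ) :
    ∫ ω, Complex.exp (θ * S ω * Complex.I) ∂P = Real.exp (-(θ ^ 2 * ∫ ω, S ω ^ 2 ∂P) / 2) := by
  have hP := hS.isProbabilityMeasure
  have h := charFun_apply_real (μ := P.map S) θ
  rw [integral_map hS.aemeasurable (by fun_prop), hS.map_eq_gaussianReal,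
    charFun_gaussianReal, variance_of_integral_eq_zero hS.aemeasurable h0, h0] at h
  rw [← h, Real.coe_toNNReal _ (integral_nonneg fun ω => sq_nonneg _)]
  push_cast
  congr 1
  ring

/-- After splitting at r, the phase of the earlier part joins V in a past-measurable factor of the
same modulus, and the independent later part contributes its Gaussian characteristic function. -/
lemma IsWhiteNoise.norm_integral_mul_cexp_stepIntegral_le (hW : IsWhiteNoise P W)
    (hWm : ∀ t A, Measurable (W t A)) {n : ℕ} (c : Fin n → ℝ) (a b : Fin n → ℝ≥0)
    (A : Fin n → BoundedBorel) {r : ℝ≥0} {V : Ω → ℝ}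
    (hV : AEStronglyMeasurable[pastSigma W r] V P) (θ : ℝ) :
    ‖∫ ω, (V ω : ℂ) * Complex.exp (θ * stepIntegral W c a b A ω * Complex.I) ∂P‖ ≤
      Real.exp (-(θ ^ 2 * ∫ ω, stepIntegral W c (fun i => max (a i) r) (fun i => max (b i) r) A ω ^ 2
        ∂P) / 2) * ∫ ω, |V ω| ∂P := by
  have hm := pastSigma_le hWm r
  set Y := stepIntegral W c (fun i => min (a i) r) (fun i => min (b i) r) A
  set Z := stepIntegral W c (fun i => max (a i) r) (fun i => max (b i) r) A
  have hYm : Measurable[pastSigma W r] Y :=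
    measurable_stepIntegral_pastSigma c A (fun i => min_le_right _ _) (fun i => min_le_right _ _)
  have hZm : AEStronglyMeasurable Z P := (hW.memLp_stepIntegral _ _ _ _).1
  obtain ⟨V', hV', hVV'⟩ := hV
  have h1 : ∫ ω, (V ω : ℂ) * Complex.exp (θ * stepIntegral W c a b A ω * Complex.I) ∂P =
      ∫ ω, ((V' ω : ℂ) * Complex.exp (θ * Y ω * Complex.I)) * Complex.exp (θ * Z ω * Complex.I) ∂P := by
    refine integral_congr_ae (hVV'.mono fun ω hω => ?_)
    simp only
    rw [hω, stepIntegral_min_add_max c a b A r ω, mul_assoc (V' ω : ℂ),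
      ← Complex.exp_add]
    congr 2
    push_cast
    ring
  have hVY : Measurable[pastSigma W r]
      (fun ω => (V' ω : ℂ) * Complex.exp (θ * Y ω * Complex.I)) := by
    have hV'm := hV'.measurable
    clear_value Y
    clear h1
    fun_prop
  have hind : IndepFun (fun ω => (V' ω : ℂ) * Complex.exp (θ * Y ω * Complex.I))
      (fun ω => Complex.exp (θ * Z ω * Complex.I)) P := by
    refine indep_of_indep_of_le_left (indep_of_indep_of_le_right
      (hW.indep_stepIntegral hWm c (fun i => max (a i) r) (fun i => max (b i) r) A
        (fun i => le_max_right _ _) (fun i => le_max_right _ _)) ?_) hVY.comap_le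
    have : Measurable (fun z : ℝ => Complex.exp (θ * z * Complex.I)) := by fun_prop
    exact (this.comp (comap_measurable Z)).comap_le
  rw [h1, hind.integral_fun_mul_eq_mul_integral (hVY.mono hm le_rfl).aestronglyMeasurable
    (Continuous.comp_aestronglyMeasurable (g := fun z : ℝ => Complex.exp (θ * z * Complex.I))
      (by fun_prop) hZm), integral_cexp_of_hasGaussianLaw
      (hW.hasGaussianLaw_stepIntegral _ _ _ _) (hW.integral_stepIntegral _ _ _ _), norm_mul, mul_comm]
  refine mul_le_mul (by rw [Complex.norm_real, Real.norm_of_nonneg (Real.exp_nonneg _)]) ?_ (norm_nonneg _) (Real.exp_nonneg _)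
  refine (norm_integral_le_integral_norm _).trans_eq (integral_congr_ae (hVV'.mono fun ω hω => ?_))
  simp only [norm_mul, hω, Complex.norm_real, Real.norm_eq_abs]
  rw [← Complex.ofReal_mul, Complex.norm_exp_ofReal_mul_I, mul_one]

lemma norm_cexp_mul_I_sub_le (x y : ℝ) :
    ‖Complex.exp (x * Complex.I) - Complex.exp (y * Complex.I)‖ ≤ |x - y| := by
  have h : Complex.exp (x * Complex.I) - Complex.exp (y * Complex.I) =
      Complex.exp (y * Complex.I) * (Complex.exp (Complex.I * ((x - y : ℝ) : ℂ)) - 1) := by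
    rw [mul_sub, ← Complex.exp_add, mul_one]
    congr 2
    push_cast
    ring
  rw [h, norm_mul, Complex.norm_exp_ofReal_mul_I, one_mul]
  exact Real.norm_exp_I_mul_ofReal_sub_one_le

lemma integrable_ofReal_mul_cexp [IsFiniteMeasure P] {V : Ω → ℝ} (hV : AEStronglyMeasurable V P)
    {M : ℝ} (hM : ∀ ω, |V ω| ≤ M) {Y : Ω → ℝ} (hY : AEStronglyMeasurable Y P) (θ : ℝ) :
    Integrable (fun ω => (V ω : ℂ) * Complex.exp (θ * Y ω * Complex.I)) P := by
  refine Integrable.of_bound (C := M) (AEStronglyMeasurable.mul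
    (Complex.continuous_ofReal.comp_aestronglyMeasurable hV)
    (Continuous.comp_aestronglyMeasurable (g := fun z : ℝ => Complex.exp (θ * z * Complex.I))
      (by fun_prop) hY)) (ae_of_all _ fun ω => ?_)
  rw [norm_mul, ← Complex.ofReal_mul, Complex.norm_exp_ofReal_mul_I, mul_one, Complex.norm_real]
  exact hM ω

/-- One-sided local nondeterminism: the conditional characteristic function, given the noise up to
time `r`, is bounded by that of the part of the integral after time `r`. -/
lemma IsWienerIntegral.norm_integral_mul_cexp_le [IsProbabilityMeasure P] (hW : IsWhiteNoise P W)
    (hWm : ∀ t A, Measurable (W t A)) {f : ℝ × ℝ → ℝ} {X : Ω → ℝ} (hX : IsWienerIntegral P W f X)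
    {r : ℝ≥0} {σ : ℝ}
    (hf : ENNReal.ofReal σ ≤ eLpNorm ((Ioi (r : ℝ) ×ˢ (univ : Set ℝ)).indicator f) 2 halfPlaneVolume)
    (hσ : 0 ≤ σ) {V : Ω → ℝ} (hV : AEStronglyMeasurable[pastSigma W r] V P) {M : ℝ}
    (hM : ∀ ω, |V ω| ≤ M) (θ : ℝ) :
    ‖∫ ω, (V ω : ℂ) * Complex.exp (θ * X ω * Complex.I) ∂P‖ ≤
      Real.exp (-(θ ^ 2 * σ ^ 2) / 2) * ∫ ω, |V ω| ∂P := by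
  have hm := pastSigma_le hWm r
  have hM0 : 0 ≤ M := by
    obtain ⟨ω⟩ := nonempty_of_isProbabilityMeasure P
    exact (abs_nonneg _).trans (hM ω)
  have hVm : AEStronglyMeasurable V P := hV.mono hm
  -- For a step integral S within ε of X, the part after r has L² norm at least σ - ε, and replacing
  -- X by S in the exponential costs at most M|θ|ε. The truncation at 0 allows the lower bound to be
  -- squared even when ε > σ.
  have key : ∀ ε : ℝ, 0 < ε → ‖∫ ω, (V ω : ℂ) * Complex.exp (θ * X ω * Complex.I) ∂P‖ ≤
      Real.exp (-(θ ^ 2 * (max (σ - ε) 0) ^ 2) / 2) * ∫ ω, |V ω| ∂P + M * (|θ| * ε) := by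
    intro ε hε
    obtain ⟨n, c, a, b, A, hab, h1, h2⟩ := hX.2.2 (ENNReal.ofReal ε) (by simpa using hε)
    set S := stepIntegral W c a b A
    set Z := stepIntegral W c (fun i => max (a i) r) (fun i => max (b i) r) A
    have hS : MemLp S 2 P := hW.memLp_stepIntegral _ _ _ _
    have hZ : MemLp Z 2 P := hW.memLp_stepIntegral _ _ _ _
    have hR : MeasurableSet (Ioi (r : ℝ) ×ˢ (univ : Set ℝ)) := measurableSet_Ioi.prod .univ
    have hZn : max (σ - ε) 0 ≤ √(∫ ω, Z ω ^ 2 ∂P) := by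
      refine max_le ?_ (Real.sqrt_nonneg _)
      have h3 : ENNReal.ofReal σ ≤ ENNReal.ofReal (ε + √(∫ ω, Z ω ^ 2 ∂P)) := by
        rw [ENNReal.ofReal_add hε.le (Real.sqrt_nonneg _), ← eLpNorm_two_eq_sqrt hZ,
          hW.eLpNorm_stepIntegral _ _ _ _ (fun i => max_le_max_right r (hab i)), stepFun_max]
        have h4 : (Ioi (r : ℝ) ×ˢ (univ : Set ℝ)).indicator f =
            (Ioi (r : ℝ) ×ˢ (univ : Set ℝ)).indicator (fun p => f p - stepFun c a b A p) +
              (Ioi (r : ℝ) ×ˢ (univ : Set ℝ)).indicator (stepFun c a b A) := by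
          rw [← indicator_add']
          congr 1
          ext p
          simp
        refine hf.trans ?_
        rw [h4]
        refine (eLpNorm_add_le ?_ ?_ (by simp)).trans
          (add_le_add_left ((eLpNorm_indicator_le _).trans h1.le) _)
        · exact (hX.1.sub (memLp_stepFun c a b A)).1.indicator hR
        · exact (memLp_stepFun c a b A).1.indicator hR
      have := (ENNReal.ofReal_le_ofReal_iff (by positivity)).1 h3
      linarith
    have hD : ∫ ω, |X ω - S ω| ∂P ≤ ε := by
      have hD2 : MemLp (fun ω => X ω - S ω) 2 P := hX.2.1.sub hS
      have h5 := eLpNorm_le_eLpNorm_of_exponent_le (p := 1) (q := 2) (by simp) hD2.1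
      have h6 : eLpNorm (fun ω => X ω - S ω) 1 P = ENNReal.ofReal (∫ ω, |X ω - S ω| ∂P) := by
        rw [eLpNorm_one_eq_lintegral_enorm, ← ofReal_integral_norm_eq_lintegral_enorm
          (hD2.integrable (by simp))]
        simp
      rw [h6] at h5
      exact (ENNReal.ofReal_le_ofReal_iff hε.le).1 (h5.trans h2.le)
    have h7 : ∫ ω, (V ω : ℂ) * Complex.exp (θ * X ω * Complex.I) ∂P =
        ∫ ω, (V ω : ℂ) * Complex.exp (θ * S ω * Complex.I) ∂P +
        ∫ ω, ((V ω : ℂ) * Complex.exp (θ * X ω * Complex.I) -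
          (V ω : ℂ) * Complex.exp (θ * S ω * Complex.I)) ∂P := by
      rw [integral_sub (integrable_ofReal_mul_cexp hVm hM hX.2.1.1 θ) (integrable_ofReal_mul_cexp hVm hM hS.1 θ)]
      ring
    rw [h7]
    refine (norm_add_le _ _).trans (add_le_add ?_ ?_)
    · refine (hW.norm_integral_mul_cexp_stepIntegral_le hWm c a b A hV θ).trans ?_
      refine mul_le_mul_of_nonneg_right (Real.exp_le_exp.2 ?_) (integral_nonneg fun _ => abs_nonneg _)
      have h8 : (max (σ - ε) 0) ^ 2 ≤ ∫ ω, Z ω ^ 2 ∂P := by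
        rw [← Real.sq_sqrt (integral_nonneg fun ω => sq_nonneg (Z ω))]
        exact pow_le_pow_left₀ (le_max_right _ _) hZn 2
      have := mul_le_mul_of_nonneg_left h8 (sq_nonneg θ)
      simp only [Z] at this ⊢
      linarith
    · refine (norm_integral_le_integral_norm _).trans ?_
      have hint : Integrable (fun ω => M * (|θ| * |X ω - S ω|)) P :=
        (((hX.2.1.sub hS).integrable (by simp)).abs.const_mul _).const_mul _
      calc ∫ ω, ‖(V ω : ℂ) * Complex.exp (θ * X ω * Complex.I) -
          (V ω : ℂ) * Complex.exp (θ * S ω * Complex.I)‖ ∂P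
          ≤ ∫ ω, M * (|θ| * |X ω - S ω|) ∂P := by
            refine integral_mono ((integrable_ofReal_mul_cexp hVm hM hX.2.1.1 θ).sub (integrable_ofReal_mul_cexp hVm hM hS.1 θ)).norm hint fun ω => ?_
            simp only
            rw [← mul_sub, norm_mul, Complex.norm_real, ← abs_mul, mul_sub]
            refine mul_le_mul (hM ω) ?_ (norm_nonneg _) hM0
            simpa using norm_cexp_mul_I_sub_le (θ * X ω) (θ * S ω)
        _ ≤ M * (|θ| * ε) := by
            rw [integral_const_mul, integral_const_mul]
            gcongr
  have hcont : Continuous fun ε : ℝ =>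
      Real.exp (-(θ ^ 2 * (max (σ - ε) 0) ^ 2) / 2) * ∫ ω, |V ω| ∂P + M * (|θ| * ε) := by fun_prop
  have hlim := (hcont.tendsto 0).mono_left (nhdsWithin_le_nhds (s := Ioi 0))
  rw [sub_zero, max_eq_left hσ, mul_zero, mul_zero, add_zero] at hlim
  exact ge_of_tendsto hlim (Filter.eventually_of_mem self_mem_nhdsWithin key)

end WienerIntegral

/-! ### Square integrals of the heat kernel -/

section HeatKernel

lemma measurable_heatKernel : Measurable (fun p : ℝ × ℝ => heatKernel p.1 p.2) := by
  unfold heatKernel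
  exact Measurable.ite (measurableSet_lt measurable_const measurable_fst) (by fun_prop) (by fun_prop)

lemma lintegral_heatKernel_sq {t : ℝ} (ht : 0 < t) (x : ℝ) :
    ∫⁻ y, ‖heatKernel t (x - y)‖ₑ ^ 2 = ENNReal.ofReal ((2 * √(Real.pi * t))⁻¹) := by
  have h1 : ∀ y, heatKernel t (x - y) ^ 2 =
      (2 * Real.pi * t)⁻¹ * Real.exp (-(1 / t) * (x - y) ^ 2) := by
    intro y
    have h0 : 0 ≤ 2 * Real.pi * t := by positivity
    rw [heatKernel, if_pos ht, mul_pow, inv_pow, Real.sq_sqrt h0, sq (Real.exp _), ← Real.exp_add]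
    congr 2
    field_simp
    ring
  have h2 : ∀ y, ‖heatKernel t (x - y)‖ₑ ^ 2 = ENNReal.ofReal (heatKernel t (x - y) ^ 2) := by
    intro y
    rw [← ofReal_norm, ← ENNReal.ofReal_pow (norm_nonneg _), Real.norm_eq_abs, sq_abs]
  simp_rw [h2, h1]
  have hi : Integrable (fun y => (2 * Real.pi * t)⁻¹ * Real.exp (-(1 / t) * (x - y) ^ 2)) := by
    have := ((integrable_exp_neg_mul_sq (b := 1 / t) (by positivity)).comp_sub_left x)
    exact this.const_mul _
  rw [← ofReal_integral_eq_lintegral_ofReal hi (ae_of_all _ fun y => by positivity),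
    integral_const_mul, integral_sub_left_eq_self (fun y => Real.exp (-(1 / t) * y ^ 2)) volume x,
    integral_gaussian]
  congr 1
  have h3 : Real.pi / (1 / t) = Real.pi * t := by field_simp
  have h4 : √(Real.pi * t) ≠ 0 := by positivity
  rw [h3]
  field_simp
  rw [Real.sq_sqrt (by positivity)]

/-- The squared norm is the integral of (2√(π(s-q)))⁻¹ over r < q < s. Bounding the integrand below
by its value at q = r loses only a factor 2 and avoids the singular integral. -/
lemma ofReal_le_eLpNorm_heatKernel {r : ℝ≥0} {s : ℝ} (hrs : (r : ℝ) < s) (x : ℝ) :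
    ENNReal.ofReal √(√(s - r) / (2 * √Real.pi)) ≤
      eLpNorm ((Ioi (r : ℝ) ×ˢ (univ : Set ℝ)).indicator
        (fun p : ℝ × ℝ => heatKernel (s - p.1) (x - p.2))) 2 halfPlaneVolume := by
  have hmk : Measurable (fun p : ℝ × ℝ => heatKernel (s - p.1) (x - p.2)) :=
    measurable_heatKernel.comp (f := fun p : ℝ × ℝ => (s - p.1, x - p.2)) (by fun_prop)
  have hpos : 0 < s - r := sub_pos.2 hrs
  have hR : MeasurableSet (Ioi (r : ℝ) ×ˢ (univ : Set ℝ)) := measurableSet_Ioi.prod .univ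
  rw [eLpNorm_eq_lintegral_rpow_enorm_toReal (by simp) (by simp), ENNReal.toReal_ofNat,
    one_div, ENNReal.le_rpow_inv_iff (by norm_num), ENNReal.ofReal_rpow_of_nonneg (Real.sqrt_nonneg _)
    (by norm_num), Real.rpow_two, Real.sq_sqrt (by positivity)]
  calc ENNReal.ofReal (√(s - r) / (2 * √Real.pi))
      = ∫⁻ _ in Ioo (r : ℝ) s, ENNReal.ofReal ((2 * √(Real.pi * (s - r)))⁻¹) := by
        rw [setLIntegral_const, Real.volume_Ioo, ← ENNReal.ofReal_mul (by positivity)]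
        congr 1
        rw [Real.sqrt_mul Real.pi_pos.le]
        have h1 := Real.sq_sqrt hpos.le
        have h2 : √(s - r) ≠ 0 := by positivity
        field_simp
        exact h1
    _ ≤ ∫⁻ q in Ioo (r : ℝ) s, ∫⁻ y, ‖heatKernel (s - q) (x - y)‖ₑ ^ 2 := by
        refine setLIntegral_mono' measurableSet_Ioo fun q hq => ?_
        rw [lintegral_heatKernel_sq (sub_pos.2 hq.2)]
        have h0 : 0 < s - q := sub_pos.2 hq.2
        refine ENNReal.ofReal_le_ofReal (inv_anti₀ (by positivity) ?_)
        gcongr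
        exact hq.1.le
    _ = ∫⁻ p in Ioo (r : ℝ) s ×ˢ (univ : Set ℝ), ‖heatKernel (s - p.1) (x - p.2)‖ₑ ^ 2 := by
        rw [Measure.volume_eq_prod, ← Measure.prod_restrict, Measure.restrict_univ,
          lintegral_prod _ (hmk.enorm.pow_const 2).aemeasurable]
    _ = ∫⁻ p in Ioo (r : ℝ) s ×ˢ (univ : Set ℝ), ‖(Ioi (r : ℝ) ×ˢ (univ : Set ℝ)).indicator
          (fun p : ℝ × ℝ => heatKernel (s - p.1) (x - p.2)) p‖ₑ ^ (2 : ℝ) := by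
        refine setLIntegral_congr_fun (measurableSet_Ioo.prod .univ) fun p hp => ?_
        have hp' : p ∈ Ioi (r : ℝ) ×ˢ (univ : Set ℝ) := ⟨hp.1.1, trivial⟩
        simp only [indicator_of_mem hp', ENNReal.rpow_two]
    _ ≤ _ := by
        refine lintegral_mono' (Measure.restrict_mono (prod_mono (fun q hq => ?_) le_rfl) le_rfl) le_rfl
        exact r.2.trans hq.1.le

end HeatKernel

/-! ### Moments of running integrals -/

section RunningIntegral

lemma AbsolutelyContinuousOnInterval.pow {f : ℝ → ℝ} {a b : ℝ}
    (hf : AbsolutelyContinuousOnInterval f a b) (n : ℕ) :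
    AbsolutelyContinuousOnInterval (fun x => f x ^ n) a b := by
  induction n with
  | zero =>
    simpa using ((LipschitzWith.const (1 : ℝ)).lipschitzOnWith (s := uIcc a b)).absolutelyContinuousOnInterval
  | succ n ih => simpa [pow_succ] using ih.fun_mul hf

/-- The power rule for the running integral of an integrable function. -/
lemma intervalIntegral_pow_succ {g : ℝ → ℝ} {a b : ℝ} (hg : IntervalIntegrable g volume a b) (n : ℕ) :
    (∫ q in a..b, g q) ^ (n + 1) = (n + 1) * ∫ s in a..b, (∫ q in a..s, g q) ^ n * g s := by
  -- As g is only integrable, its primitive is differentiable only almost everywhere; absolute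
  -- continuity still gives the fundamental theorem for its powers.
  have hF := hg.absolutelyContinuousOnInterval_intervalIntegral (c := a) left_mem_uIcc
  have h := (hF.pow (n + 1)).integral_deriv_eq_sub
  simp only [intervalIntegral.integral_same, ne_eq, Nat.add_eq_zero_iff, one_ne_zero, and_false,
    not_false_eq_true, zero_pow, sub_zero] at h
  rw [← h, ← intervalIntegral.integral_const_mul]
  refine intervalIntegral.integral_congr_ae ?_
  filter_upwards [hg.ae_hasDerivAt_integral] with x hx hxm
  rw [((hx (uIoc_subset_uIcc hxm) a left_mem_uIcc).fun_pow (n + 1)).deriv]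
  push_cast
  ring

variable {Ω : Type*} [MeasurableSpace Ω] {P : Measure Ω}

lemma measurable_runningIntegral {E : Type*} [NormedAddCommGroup E] [NormedSpace ℝ E]
    [MeasurableSpace E] [BorelSpace E] [SecondCountableTopology E] {g : Ω → ℝ → E}
    (hg : Measurable (Function.uncurry g)) (a : ℝ) :
    Measurable (fun p : Ω × ℝ => ∫ q in a..p.2, g p.1 q) := by
  have h : ∀ {f₁ f₂ : Ω × ℝ → ℝ}, Measurable f₁ → Measurable f₂ →
      StronglyMeasurable (fun p : Ω × ℝ => ∫ q in Ioc (f₁ p) (f₂ p), g p.1 q) := by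
    intro f₁ f₂ h₁ h₂
    simp_rw [← integral_indicator measurableSet_Ioc]
    refine StronglyMeasurable.integral_prod_right (f := fun (p : Ω × ℝ) q =>
      (Ioc (f₁ p) (f₂ p)).indicator (fun q => g p.1 q) q) (Measurable.stronglyMeasurable ?_)
    have hS : MeasurableSet {z : (Ω × ℝ) × ℝ | z.2 ∈ Ioc (f₁ z.1) (f₂ z.1)} :=
      (measurableSet_lt (h₁.comp measurable_fst) measurable_snd).inter
        (measurableSet_le measurable_snd (h₂.comp measurable_fst))
    have hgm : Measurable (fun z : (Ω × ℝ) × ℝ => g z.1.1 z.2) :=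
      hg.comp ((measurable_fst.comp measurable_fst).prodMk measurable_snd)
    exact hgm.indicator hS
  exact ((h measurable_const measurable_snd).sub (h measurable_snd measurable_const)).measurable

lemma measurable_intervalIntegral {E : Type*} [NormedAddCommGroup E] [NormedSpace ℝ E]
    [MeasurableSpace E] [BorelSpace E] [SecondCountableTopology E] {g : Ω → ℝ → E}
    (hg : Measurable (Function.uncurry g)) (a b : ℝ) :
    Measurable (fun ω => ∫ q in a..b, g ω q) :=
  (measurable_runningIntegral hg a).comp (measurable_prodMk_right (y := b))

lemma intervalIntegrable_of_abs_le_one {g : ℝ → ℝ} (hg : Measurable g) (hb : ∀ q, |g q| ≤ 1)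
    (a b : ℝ) : IntervalIntegrable g volume a b :=
  (intervalIntegrable_const (c := (1 : ℝ))).mono_fun hg.aestronglyMeasurable
    (ae_of_all _ fun q => by simpa using hb q)

lemma abs_intervalIntegral_le_of_abs_le_one {g : ℝ → ℝ} (hb : ∀ q, |g q| ≤ 1) {a b : ℝ}
    (hab : a ≤ b) : |∫ q in a..b, g q| ≤ b - a := by
  have := intervalIntegral.norm_integral_le_of_norm_le_const (a := a) (b := b) (f := g) (C := 1)
    (fun q _ => hb q)
  rwa [one_mul, abs_of_nonneg (sub_nonneg.2 hab)] at this

lemma integral_intervalIntegral_swap_of_bounded [IsFiniteMeasure P] {F : Ω → ℝ → ℝ} {a b C : ℝ}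
    (hab : a ≤ b) (hF : Measurable (Function.uncurry F)) (hC : ∀ ω, ∀ s ∈ Ioc a b, |F ω s| ≤ C) :
    ∫ ω, (∫ s in a..b, F ω s) ∂P = ∫ s in a..b, (∫ ω, F ω s ∂P) := by
  simp_rw [intervalIntegral.integral_of_le hab]
  refine integral_integral_swap (Integrable.of_bound (C := C) hF.aestronglyMeasurable ?_)
  have h : ∀ᵐ p ∂(P.prod (volume.restrict (Ioc a b))), p.2 ∈ Ioc a b :=
    Measure.quasiMeasurePreserving_snd.ae (ae_restrict_mem measurableSet_Ioc)
  exact h.mono fun p hp => hC p.1 p.2 hp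

/-- Moment bound for the running integral of a process whose conditional means decay. -/
lemma integral_runningIntegral_pow_le [IsProbabilityMeasure P] {g : Ω → ℝ → ℝ}
    (hg : Measurable (Function.uncurry g)) (hb : ∀ ω q, |g ω q| ≤ 1) {a b : ℝ} {κ : ℝ → ℝ → ℝ} {k : ℝ}
    (hκi : ∀ s, IntervalIntegrable (κ s) volume a s)
    (hκ0 : ∀ s r, r ≤ s → 0 ≤ κ s r)
    (hk : ∀ s ∈ Ioc a b, ∫ r in a..s, κ s r ≤ k)
    (H : ∀ n : ℕ, ∀ᵐ s, s ∈ Ioc a b → ∀ᵐ r, r ∈ Ioc a s →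
      |∫ ω, (∫ q in a..r, g ω q) ^ (2 * n) * g ω r * g ω s ∂P| ≤
        κ s r * ∫ ω, (∫ q in a..r, g ω q) ^ (2 * n) ∂P) (n : ℕ) :
    ∀ e ∈ Icc a b, ∫ ω, (∫ q in a..e, g ω q) ^ (2 * n) ∂P ≤
      (2 * n).factorial * (k * (b - a)) ^ n := by
  have hgm : ∀ ω, Measurable (g ω) := fun ω => hg.of_uncurry_left
  have hgi : ∀ ω s t, IntervalIntegrable (g ω) volume s t := fun ω s t =>
    intervalIntegrable_of_abs_le_one (hgm ω) (hb ω) s t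
  have hBm := measurable_runningIntegral hg a
  have hBb : ∀ ω, ∀ r, a ≤ r → r ≤ b → |∫ q in a..r, g ω q| ≤ b - a := fun ω r h1 h2 =>
    (abs_intervalIntegral_le_of_abs_le_one (hb ω) h1).trans (by linarith)
  -- Each step peels off the two latest times r < s. The power of B left at time r is even, hence
  -- nonnegative, so the right side of `H` is the previous moment, to which the induction hypothesis
  -- applies at time r.
  induction n with
  | zero => intro e _; simp
  | succ n ih =>
    intro e he
    have hk0 : 0 ≤ b - a := by linarith [he.1, he.2]
    -- The sign of `k` comes only from `hk`, which requires a time beyond `a`; hence the separate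
    -- degenerate cases.
    rcases eq_or_lt_of_le he.1 with hae | hae
    · subst hae
      simp only [intervalIntegral.integral_same]
      rcases eq_or_lt_of_le hk0 with h | h
      · simp [← h]
      · have : 0 ≤ k := (intervalIntegral.integral_nonneg (by linarith) fun _ h => hκ0 _ _ h.2).trans
          (hk b ⟨by linarith, le_rfl⟩)
        simp only [mul_add, mul_one, ne_eq, Nat.add_eq_zero_iff, OfNat.ofNat_ne_zero, and_false,
          not_false_eq_true, zero_pow, integral_zero]
        positivity
    set D : ℝ := (2 * n).factorial * (k * (b - a)) ^ n
    have hD : 0 ≤ D := by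
      refine le_trans (integral_nonneg fun ω => ?_) (ih e he)
      exact (even_two_mul n).pow_nonneg _
    have hk' : 0 ≤ k := (intervalIntegral.integral_nonneg hae.le fun _ h => hκ0 _ _ h.2).trans
      (hk e ⟨hae, he.2⟩)
    have inner : ∀ᵐ s, s ∈ Ioc a e →
        ‖∫ ω, (∫ q in a..s, g ω q) ^ (2 * n + 1) * g ω s ∂P‖ ≤ (2 * n + 1) * (D * k) := by
      filter_upwards [H n] with s hs hse
      have hsb : s ∈ Ioc a b := ⟨hse.1, hse.2.trans he.2⟩
      have h1 : ∀ ω, (∫ q in a..s, g ω q) ^ (2 * n + 1) * g ω s =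
          (2 * n + 1) * ∫ r in a..s, (∫ q in a..r, g ω q) ^ (2 * n) * g ω r * g ω s := by
        intro ω
        rw [intervalIntegral_pow_succ (hgi ω a s), intervalIntegral.integral_mul_const]
        push_cast
        ring
      simp_rw [h1]
      rw [integral_const_mul, norm_mul, Real.norm_of_nonneg (by positivity)]
      refine mul_le_mul_of_nonneg_left ?_ (by positivity)
      rw [integral_intervalIntegral_swap_of_bounded (C := (b - a) ^ (2 * n)) hse.1.le]
      · refine (intervalIntegral.norm_integral_le_of_norm_le hse.1.le
          (g := fun r => κ s r * D) ?_ ((hκi s).mul_const D)).trans ?_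
        · filter_upwards [hs hsb] with r hr hrs
          refine (hr hrs).trans (mul_le_mul_of_nonneg_left (ih r ?_) (hκ0 s r hrs.2))
          exact ⟨hrs.1.le, hrs.2.trans hsb.2⟩
        · rw [intervalIntegral.integral_mul_const, mul_comm]
          exact mul_le_mul_of_nonneg_left (hk s hsb) hD
      · have h3 : Measurable (fun p : Ω × ℝ => g p.1 s) :=
          hg.comp (measurable_fst.prodMk measurable_const)
        exact ((hBm.pow_const _).mul hg).mul h3
      · intro ω r hr
        have h4 := hBb ω r hr.1.le (hr.2.trans hsb.2)
        rw [abs_mul, abs_mul, abs_pow]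
        calc |∫ q in a..r, g ω q| ^ (2 * n) * |g ω r| * |g ω s| ≤ (b - a) ^ (2 * n) * 1 * 1 := by
              gcongr
              · exact hb ω r
              · exact hb ω s
          _ = _ := by ring
    have h2 : ∀ ω, (∫ q in a..e, g ω q) ^ (2 * (n + 1)) =
        (2 * n + 2) * ∫ s in a..e, (∫ q in a..s, g ω q) ^ (2 * n + 1) * g ω s := by
      intro ω
      rw [show 2 * (n + 1) = 2 * n + 1 + 1 by ring, intervalIntegral_pow_succ (hgi ω a e)]
      push_cast
      ring
    simp_rw [h2]
    rw [integral_const_mul, integral_intervalIntegral_swap_of_bounded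
      (C := (b - a) ^ (2 * n + 1)) hae.le ((hBm.pow_const _).mul hg)]
    · have h5 := intervalIntegral.norm_integral_le_of_norm_le hae.le inner intervalIntegrable_const
      rw [intervalIntegral.integral_const, smul_eq_mul] at h5
      have h6 := (le_abs_self _).trans h5
      calc _ ≤ (2 * n + 2 : ℝ) * ((e - a) * ((2 * n + 1) * (D * k))) := by gcongr
        _ ≤ (2 * n + 2 : ℝ) * ((b - a) * ((2 * n + 1) * (D * k))) := by
          gcongr
          exact he.2
        _ = _ := by
          rw [show 2 * (n + 1) = 2 * n + 1 + 1 by ring, Nat.factorial_succ, Nat.factorial_succ]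
          simp only [D]
          push_cast
          ring
    · intro ω s hs
      rw [abs_mul, abs_pow]
      have h4 := hBb ω s hs.1.le (hs.2.trans he.2)
      calc |∫ q in a..s, g ω q| ^ (2 * n + 1) * |g ω s| ≤ (b - a) ^ (2 * n + 1) * 1 := by
            gcongr
            exact hb ω s
        _ = _ := by ring

end RunningIntegral

/-! ### Adaptedness of running integrals -/

section PastRunningIntegral

variable {Ω : Type*} {m m0 : MeasurableSpace Ω} {P : Measure Ω}

/-- The running integral of a process adapted to `m` is `m`-measurable up to a null set. -/
lemma aestronglyMeasurable_runningIntegral [IsProbabilityMeasure P] (hm : m ≤ m0) {g : Ω → ℝ → ℝ}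
    (hg : Measurable (Function.uncurry g)) (hb : ∀ ω q, |g ω q| ≤ 1) {a r : ℝ} (har : a ≤ r)
    (hgm : ∀ᵐ q, q ∈ Ioc a r → AEStronglyMeasurable[m] (fun ω => g ω q) P) :
    AEStronglyMeasurable[m] (fun ω => ∫ q in a..r, g ω q) P := by
  set B : Ω → ℝ := fun ω => ∫ q in a..r, g ω q
  have hBm : Measurable B := measurable_intervalIntegral hg a r
  have hBb : ∀ ω, |B ω| ≤ r - a := fun ω => abs_intervalIntegral_le_of_abs_le_one (hb ω) har
  have hBi : Integrable B P := Integrable.of_bound hBm.aestronglyMeasurable (r - a) (ae_of_all _ hBb)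
  have hEb : ∀ᵐ ω ∂P, |(P[B|m]) ω| ≤ r - a := ae_bdd_abs_condExp_of_ae_bdd_abs (ae_of_all _ hBb)
  -- Joint measurability of g with respect to m is not available, only measurability at almost every
  -- single time. But Z is orthogonal to m-measurable factors, so to almost every g(·,q), and by
  -- Fubini to B itself. Hence E[Z²] = 0.
  set Z : Ω → ℝ := B - P[B|m]
  have hZi : Integrable Z P := hBi.sub integrable_condExp
  have hZ0 : P[Z|m] =ᵐ[P] 0 := by
    refine (condExp_sub hBi integrable_condExp m).trans ?_
    rw [condExp_of_stronglyMeasurable hm stronglyMeasurable_condExp integrable_condExp, sub_self]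
  have horth : ∀ Y : Ω → ℝ, AEStronglyMeasurable[m] Y P → Integrable (fun ω => Y ω * Z ω) P →
      ∫ ω, Y ω * Z ω ∂P = 0 := by
    intro Y hY hYi
    rw [← integral_condExp hm]
    have h := condExp_mul_of_aestronglyMeasurable_left hY hYi hZi
    refine (integral_congr_ae (g := fun _ => (0 : ℝ)) (h.trans (hZ0.mono fun ω hω => ?_))).trans
      (by simp)
    simp [hω]
  have hEZ : ∫ ω, (P[B|m]) ω * Z ω ∂P = 0 := by
    refine horth _ stronglyMeasurable_condExp.aestronglyMeasurable ?_
    exact hZi.bdd_mul integrable_condExp.aestronglyMeasurable hEb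
  have hBZ : ∫ ω, B ω * Z ω ∂P = 0 := by
    have h1 : ∀ ω, B ω * Z ω = ∫ q in Ioc a r, g ω q * Z ω := by
      intro ω
      rw [integral_mul_const, ← intervalIntegral.integral_of_le har]
    simp_rw [h1]
    rw [integral_integral_swap]
    · rw [← integral_zero ℝ ℝ (μ := volume.restrict (Ioc a r))]
      refine integral_congr_ae ((ae_restrict_iff' measurableSet_Ioc).2 (hgm.mono fun q hq hqm => ?_))
      refine horth _ (hq hqm) (hZi.bdd_mul (c := 1) ?_ (ae_of_all _ fun ω => hb ω q))
      exact (hg.comp (measurable_id.prodMk measurable_const)).aestronglyMeasurable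
    · exact (hZi.comp_fst (volume.restrict (Ioc a r))).bdd_mul (c := 1) hg.aestronglyMeasurable
        (ae_of_all _ fun p => hb p.1 p.2)
  have hZb : ∀ᵐ ω ∂P, |Z ω| ≤ (r - a) + (r - a) := hEb.mono fun ω hω =>
    (abs_sub _ _).trans (add_le_add (hBb ω) hω)
  have hZZ : ∫ ω, Z ω * Z ω ∂P = 0 := by
    have h2 : ∀ ω, Z ω * Z ω = B ω * Z ω - (P[B|m]) ω * Z ω := fun ω => by
      simp only [Z, Pi.sub_apply]; ring
    simp_rw [h2]
    rw [integral_sub (hZi.bdd_mul hBm.aestronglyMeasurable (ae_of_all _ hBb))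
      (hZi.bdd_mul integrable_condExp.aestronglyMeasurable hEb), hBZ, hEZ, sub_zero]
  have hZae : Z =ᵐ[P] 0 := by
    have := (integral_eq_zero_iff_of_nonneg (fun ω => mul_self_nonneg (Z ω))
      (hZi.bdd_mul hZi.aestronglyMeasurable hZb)).1 hZZ
    exact this.mono fun ω hω => mul_self_eq_zero.1 hω
  refine ⟨P[B|m], stronglyMeasurable_condExp, hZae.mono fun ω hω => ?_⟩
  simpa [Z, sub_eq_zero] using hω

end PastRunningIntegral

/-! ### Conditional decay and moment bounds for the solution -/

section Moments

/-- Follows from y ≤ exp y at y = x/s, raised to the power s. -/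
lemma exp_neg_le_rpow {x s : ℝ} (hx : 0 < x) (hs : 0 < s) :
    Real.exp (-x) ≤ (x / s) ^ (-s) := by
  have h : x / s ≤ Real.exp (x / s) := by linarith [Real.add_one_le_exp (x / s)]
  have h2 : (x / s) ^ s ≤ Real.exp x := by
    calc (x / s) ^ s ≤ Real.exp (x / s) ^ s := Real.rpow_le_rpow (by positivity) h hs.le
      _ = Real.exp x := by rw [← Real.exp_mul]; congr 1; field_simp
  rw [Real.exp_neg, Real.rpow_neg (by positivity)]
  exact inv_anti₀ (by positivity) h2

/-- Trades Gaussian decay for a power of h that is integrable at 0 when γ < 1. The factor exp(c√T)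
pays for replacing θ² by 1+θ², which keeps the weight finite at θ = 0. -/
lemma exp_neg_sq_mul_sqrt_le {c γ T : ℝ} (hc : 0 < c) (hγ : 0 < γ) {θ h : ℝ} (hh : 0 < h)
    (hT : h ≤ T) :
    Real.exp (-(c * θ ^ 2 * √h)) ≤
      (Real.exp (c * √T) * (c / (2 * γ)) ^ (-(2 * γ))) * (1 + θ ^ 2) ^ (-(2 * γ)) * h ^ (-γ) := by
  have h1 : Real.exp (-(c * θ ^ 2 * √h)) =
      Real.exp (c * √h) * Real.exp (-(c * (1 + θ ^ 2) * √h)) := by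
    rw [← Real.exp_add]; congr 1; ring
  have h2 : h ^ (-γ) = √h ^ (-(2 * γ)) := by
    rw [Real.sqrt_eq_rpow, ← Real.rpow_mul hh.le]; congr 1; ring
  have h3 : c * (1 + θ ^ 2) * √h / (2 * γ) = c / (2 * γ) * (1 + θ ^ 2) * √h := by ring
  have h4 := exp_neg_le_rpow (x := c * (1 + θ ^ 2) * √h) (s := 2 * γ) (by positivity) (by positivity)
  rw [h3, Real.mul_rpow (by positivity) (by positivity), Real.mul_rpow (by positivity)
    (by positivity)] at h4
  rw [h1, h2]
  calc _ ≤ Real.exp (c * √T) *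
      ((c / (2 * γ)) ^ (-(2 * γ)) * (1 + θ ^ 2) ^ (-(2 * γ)) * √h ^ (-(2 * γ))) := by gcongr
    _ = _ := by ring

variable {Ω : Type*} [MeasurableSpace Ω] {P : Measure Ω} [IsProbabilityMeasure P]
  {W : ℝ≥0 → BoundedBorel → Ω → ℝ}

/-- Conditional decay of the trigonometric functions of the solution. -/
lemma IsMildSolution.abs_integral_mul_cos_le (hW : IsWhiteNoise P W)
    (hWm : ∀ t A, Measurable (W t A)) {u : ℝ → ℝ → Ω → ℝ} (hu : IsMildSolution P W u)
    {r : ℝ≥0} {s : ℝ} (hrs : (r : ℝ) < s) (x : ℝ) {V : Ω → ℝ}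
    (hV : AEStronglyMeasurable[pastSigma W r] V P) {M : ℝ} (hM : ∀ ω, |V ω| ≤ M) (θ φ : ℝ) :
    |∫ ω, V ω * Real.cos (θ * u s x ω + φ) ∂P| ≤
      Real.exp (-((4 * √Real.pi)⁻¹ * θ ^ 2 * √(s - r))) * ∫ ω, |V ω| ∂P := by
  have hX := hu s (r.2.trans hrs.le) x
  have h := hX.norm_integral_mul_cexp_le hW hWm (ofReal_le_eLpNorm_heatKernel hrs x)
    (Real.sqrt_nonneg _) hV hM θ
  rw [Real.sq_sqrt (by positivity)] at h
  -- The phase φ is only a constant factor of modulus one; two choices of it will cover the real and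
  -- imaginary parts of the Fourier transform.
  have h1 : ∀ ω, V ω * Real.cos (θ * u s x ω + φ) =
      RCLike.re ((V ω : ℂ) * Complex.exp (θ * u s x ω * Complex.I) * Complex.exp (φ * Complex.I)) := by
    intro ω
    rw [mul_assoc, ← Complex.exp_add, ← add_mul]
    rw [← Complex.ofReal_mul, ← Complex.ofReal_add]
    rw [RCLike.re_eq_complex_re, Complex.re_ofReal_mul, Complex.exp_ofReal_mul_I_re]
  have hVm : AEStronglyMeasurable V P := hV.mono (pastSigma_le hWm r)
  have hint := (integrable_ofReal_mul_cexp hVm hM hX.2.1.1 θ).mul_const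
    (Complex.exp (φ * Complex.I))
  simp_rw [h1]
  rw [integral_re hint, integral_mul_const]
  refine (RCLike.abs_re_le_norm _).trans ?_
  rw [norm_mul, Complex.norm_exp_ofReal_mul_I, mul_one]
  refine h.trans_eq ?_
  -- The constant (4√π)⁻¹ is half of the factor (2√π)⁻¹ in the variance bound.
  congr 2
  field_simp
  ring

/-- Moment bound for the time integral of a trigonometric function of the solution. -/
lemma IsMildSolution.integral_intervalIntegral_cos_pow_le (hW : IsWhiteNoise P W)
    (hWm : ∀ t A, Measurable (W t A)) {u : ℝ → ℝ → Ω → ℝ} (hu : IsMildSolution P W u)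
    {T x : ℝ} {v : Ω → ℝ → ℝ} (hv : Measurable (Function.uncurry v))
    (hvu : ∀ᵐ t, t ∈ Icc 0 T → (fun ω => v ω t) =ᵐ[P] u t x) {γ : ℝ} (hγ : 0 < γ) (hγ1 : γ < 1)
    (θ φ : ℝ) {a b : ℝ} (ha : 0 ≤ a) (hab : a ≤ b) (hb : b ≤ T) (n : ℕ) :
    ∫ ω, (∫ q in a..b, Real.cos (θ * v ω q + φ)) ^ (2 * n) ∂P ≤ (2 * n).factorial *
      ((Real.exp ((4 * √Real.pi)⁻¹ * √T) * ((4 * √Real.pi)⁻¹ / (2 * γ)) ^ (-(2 * γ))) *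
        (1 + θ ^ 2) ^ (-(2 * γ)) * ((b - a) ^ (1 - γ) / (1 - γ)) * (b - a)) ^ n := by
  set c : ℝ := (4 * √Real.pi)⁻¹
  have hc : 0 < c := by positivity
  set K : ℝ := (Real.exp (c * √T) * (c / (2 * γ)) ^ (-(2 * γ))) * (1 + θ ^ 2) ^ (-(2 * γ))
  have hK : 0 ≤ K := by positivity
  have hg : Measurable (Function.uncurry fun ω q => Real.cos (θ * v ω q + φ)) :=
    Real.measurable_cos.comp ((hv.const_mul θ).add_const φ)
  have hrpow : ∀ s, IntervalIntegrable (fun r => (s - r) ^ (-γ)) volume a s := by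
    intro s
    have := (intervalIntegral.intervalIntegrable_rpow' (r := -γ) (a := s - a) (b := 0)
      (by linarith)).comp_sub_left s
    simpa using this
  have hg1 : ∀ ω q, |Real.cos (θ * v ω q + φ)| ≤ 1 := fun ω q => Real.abs_cos_le_one _
  refine integral_runningIntegral_pow_le hg hg1
    (κ := fun s r => K * (s - r) ^ (-γ)) ?_ ?_ ?_ ?_ n b ⟨hab, le_rfl⟩
  · exact fun s => (hrpow s).const_mul K
  · exact fun s r h => mul_nonneg hK (Real.rpow_nonneg (by linarith) _)
  · intro s hs
    rw [intervalIntegral.integral_const_mul,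
      intervalIntegral.integral_comp_sub_left (fun x => x ^ (-γ)), sub_self,
      integral_rpow (Or.inl (by linarith)), Real.zero_rpow (by linarith), sub_zero,
      show -γ + 1 = 1 - γ by ring]
    refine mul_le_mul_of_nonneg_left ?_ hK
    have : 0 < 1 - γ := by linarith
    gcongr
    · linarith [hs.1]
    · exact hs.2
  · intro n
    filter_upwards [hvu] with s hs hsm
    have hs0 : s ∈ Icc 0 T := ⟨ha.trans hsm.1.le, hsm.2.trans hb⟩
    filter_upwards [hvu, Measure.ae_ne volume s] with r hr hne hrm
    have hrs : r < s := lt_of_le_of_ne hrm.2 hne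
    have hr0 : 0 ≤ r := ha.trans hrm.1.le
    lift r to ℝ≥0 using hr0
    -- The kernel of u(q,x) vanishes for noise times after q, hence after r. The version v inherits
    -- adaptedness only at those q where it agrees almost surely with u(q,x), which is almost every
    -- q.
    have hadapt : ∀ q ∈ Icc (0 : ℝ) r, (fun ω => v ω q) =ᵐ[P] u q x →
        AEStronglyMeasurable[pastSigma W r] (fun ω => Real.cos (θ * v ω q + φ)) P := by
      intro q hq hqu
      have h1 : AEStronglyMeasurable[pastSigma W r] (u q x) P := by
        refine (hu q hq.1 x).aestronglyMeasurable_pastSigma hW hWm fun p hp => ?_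
        have : ¬ (0 < q - p.1) := by linarith [hq.2]
        simp [heatKernel, this]
      have h2 : AEStronglyMeasurable[pastSigma W r] (fun ω => v ω q) P := h1.congr hqu.symm
      exact Continuous.comp_aestronglyMeasurable (g := fun z : ℝ => Real.cos (θ * z + φ))
        (by fun_prop) h2
    have hrT : (r : ℝ) ≤ T := hrm.2.trans hs0.2
    have hB : AEStronglyMeasurable[pastSigma W r]
        (fun ω => ∫ q in a..r, Real.cos (θ * v ω q + φ)) P := by
      refine aestronglyMeasurable_runningIntegral (pastSigma_le hWm r) hg hg1 hrm.1.le ?_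
      filter_upwards [hvu] with q hq hqm
      have hq0 : q ∈ Icc (0 : ℝ) r := ⟨ha.trans hqm.1.le, hqm.2⟩
      exact hadapt q hq0 (hq ⟨hq0.1, hq0.2.trans hrT⟩)
    have hV := (hB.pow (2 * n)).mul (hadapt r ⟨r.2, le_rfl⟩ (hr ⟨r.2, hrT⟩))
    have hpow : ∀ ω, |(∫ q in a..r, Real.cos (θ * v ω q + φ)) ^ (2 * n)| =
        (∫ q in a..r, Real.cos (θ * v ω q + φ)) ^ (2 * n) := fun ω =>
      abs_of_nonneg ((even_two_mul n).pow_nonneg _)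
    have hVb : ∀ ω, |(∫ q in a..r, Real.cos (θ * v ω q + φ)) ^ (2 * n) *
        Real.cos (θ * v ω r + φ)| ≤ (∫ q in a..r, Real.cos (θ * v ω q + φ)) ^ (2 * n) := by
      intro ω
      rw [abs_mul, hpow]
      exact mul_le_of_le_one_right ((even_two_mul n).pow_nonneg _) (hg1 ω r)
    have hBb : ∀ ω, (∫ q in a..r, Real.cos (θ * v ω q + φ)) ^ (2 * n) ≤ (r - a) ^ (2 * n) := by
      intro ω
      rw [← hpow, abs_pow]
      exact pow_le_pow_left₀ (abs_nonneg _)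
        (abs_intervalIntegral_le_of_abs_le_one (hg1 ω) hrm.1.le) _
    have h5 := hu.abs_integral_mul_cos_le hW hWm hrs x hV (M := (r - a) ^ (2 * n))
      (fun ω => (hVb ω).trans (hBb ω)) θ φ
    have h6 : ∫ ω, (∫ q in a..r, Real.cos (θ * v ω q + φ)) ^ (2 * n) *
        Real.cos (θ * v ω r + φ) * Real.cos (θ * v ω s + φ) ∂P =
        ∫ ω, (∫ q in a..r, Real.cos (θ * v ω q + φ)) ^ (2 * n) *
        Real.cos (θ * v ω r + φ) * Real.cos (θ * u s x ω + φ) ∂P :=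
      integral_congr_ae ((hs hs0).mono fun ω hω => by simp only [hω])
    rw [h6]
    refine h5.trans (mul_le_mul ?_ ?_ (integral_nonneg fun _ => abs_nonneg _) ?_)
    · exact exp_neg_sq_mul_sqrt_le hc hγ (sub_pos.2 hrs) (by linarith [hs0.2])
    · have hBi : Integrable (fun ω => (∫ q in a..r, Real.cos (θ * v ω q + φ)) ^ (2 * n)) P :=
        Integrable.of_bound (C := (r - a) ^ (2 * n))
          ((measurable_intervalIntegral hg a r).pow_const _).aestronglyMeasurable
          (ae_of_all _ fun ω => by rw [Real.norm_eq_abs, hpow]; exact hBb ω)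
      exact integral_mono_of_nonneg (ae_of_all _ fun _ => abs_nonneg _) hBi (ae_of_all _ hVb)
    · exact mul_nonneg hK (Real.rpow_nonneg (by linarith) _)

end Moments

/-! ### Fourier inversion for finite measures -/

section FourierInversion

open scoped FourierTransform SchwartzMap ContDiff

/-- Locally finite measures on the line with the same integrals of smooth compactly supported
functions agree. -/
lemma measure_ext_of_integral_contDiff {μ ν : Measure ℝ} [IsLocallyFiniteMeasure μ]
    [IsLocallyFiniteMeasure ν]
    (h : ∀ ψ : ℝ → ℝ, ContDiff ℝ ∞ ψ → HasCompactSupport ψ → ∫ x, ψ x ∂μ = ∫ x, ψ x ∂ν) :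
    μ = ν := by
  -- Bumps equal to 1 on a smaller closed ball and supported on the open ball compare the two
  -- measures; exhausting the open ball by closed ones gives one inequality, and symmetry the other.
  have key : ∀ (μ ν : Measure ℝ) [IsLocallyFiniteMeasure μ] [IsLocallyFiniteMeasure ν],
      (∀ ψ : ℝ → ℝ, ContDiff ℝ ∞ ψ → HasCompactSupport ψ → ∫ x, ψ x ∂μ = ∫ x, ψ x ∂ν) →
      ∀ c R : ℝ, μ (Metric.ball c R) ≤ ν (Metric.ball c R) := by
    intro μ ν _ _ h c R
    have hstep : ∀ r, 0 < r → r < R → μ (Metric.closedBall c r) ≤ ν (Metric.ball c R) := by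
      intro r hr hrR
      let f : ContDiffBump c := ⟨r, R, hr, hrR⟩
      have h1 := h f f.contDiff f.hasCompactSupport
      have hfμ : Integrable f μ := f.continuous.integrable_of_hasCompactSupport f.hasCompactSupport
      have hfν : Integrable f ν := f.continuous.integrable_of_hasCompactSupport f.hasCompactSupport
      have h2 : ∫⁻ x, ENNReal.ofReal (f x) ∂μ = ∫⁻ x, ENNReal.ofReal (f x) ∂ν := by
        rw [← ofReal_integral_eq_lintegral_ofReal hfμ (ae_of_all _ fun x => f.nonneg' x),
          ← ofReal_integral_eq_lintegral_ofReal hfν (ae_of_all _ fun x => f.nonneg' x), h1]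
      calc μ (Metric.closedBall c r) = ∫⁻ x in Metric.closedBall c r, 1 ∂μ := by simp
        _ = ∫⁻ x in Metric.closedBall c r, ENNReal.ofReal (f x) ∂μ :=
          setLIntegral_congr_fun Metric.isClosed_closedBall.measurableSet fun x hx => by
            simp [f.one_of_mem_closedBall hx]
        _ ≤ ∫⁻ x, ENNReal.ofReal (f x) ∂μ := setLIntegral_le_lintegral _ _
        _ = ∫⁻ x, ENNReal.ofReal (f x) ∂ν := h2
        _ ≤ ∫⁻ x, (Metric.ball c R).indicator (fun _ => 1) x ∂ν := by
          refine lintegral_mono fun x => ?_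
          by_cases hx : x ∈ Metric.ball c R
          · simp only [indicator_of_mem hx]
            exact ENNReal.ofReal_le_one.2 f.le_one
          · have : f x = 0 := by
              by_contra h0
              have : x ∈ Function.support f := h0
              rw [f.support_eq] at this
              exact hx this
            simp [this]
        _ = ν (Metric.ball c R) := by
          rw [lintegral_indicator_const Metric.isOpen_ball.measurableSet, one_mul]
    rcases le_or_gt R 0 with hR | hR
    · simp [Metric.ball_eq_empty.2 hR]
    have hU : Metric.ball c R = ⋃ n : ℕ, Metric.closedBall c (R - R / (n + 2)) := by
      ext x
      simp only [Metric.mem_ball, mem_iUnion, Metric.mem_closedBall]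
      constructor
      · intro hx
        obtain ⟨n, hn⟩ := exists_nat_gt (R / (R - dist x c))
        have h0 : 0 < R - dist x c := sub_pos.2 hx
        refine ⟨n, ?_⟩
        have h1 : R / (n + 2) ≤ R - dist x c := by
          rw [div_le_iff₀ (by positivity)]
          rw [div_lt_iff₀ h0] at hn
          nlinarith
        linarith
      · rintro ⟨n, hn⟩
        have : 0 < R / (n + 2) := by positivity
        linarith
    have hmono : Monotone fun n : ℕ => Metric.closedBall c (R - R / (n + 2)) := by
      intro n m hnm
      refine Metric.closedBall_subset_closedBall ?_
      have : (n : ℝ) ≤ m := by exact_mod_cast hnm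
      gcongr
    conv_lhs => rw [hU, hmono.measure_iUnion]
    refine iSup_le fun n => hstep _ ?_ ?_
    · rw [sub_pos, div_lt_iff₀ (by positivity)]
      have : (0 : ℝ) ≤ n := n.cast_nonneg
      nlinarith
    · have : 0 < R / ((n : ℝ) + 2) := by positivity
      linarith
  refine Real.measure_ext_Ioo_rat fun a b => ?_
  rw [Real.Ioo_eq_ball]
  exact le_antisymm (key μ ν h _ _) (key ν μ (fun ψ h1 h2 => (h ψ h1 h2).symm) _ _)

lemma continuous_fourierInv {m : ℝ → ℂ} (hm : Integrable m) : Continuous (𝓕⁻ m) := by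
  have hLc : Continuous fun p : ℝ × ℝ => (innerₗ ℝ) p.1 p.2 := continuous_inner
  exact VectorFourier.fourierIntegral_continuous Real.continuous_fourierChar hLc.neg hm

/-- A finite measure with integrable Fourier transform has the inverse transform as a continuous
density. -/
lemma eq_withDensity_of_integrable_fourier {μ : Measure ℝ} [IsFiniteMeasure μ] {m : ℝ → ℂ}
    (hm : ∀ θ, m θ = ∫ y, Complex.exp (-(2 * Real.pi * θ * y) * Complex.I) ∂μ) (hmi : Integrable m) :
    μ = volume.withDensity (fun ξ => ENNReal.ofReal (𝓕⁻ m ξ).re) ∧ ∀ᵐ ξ, 0 ≤ (𝓕⁻ m ξ).re := by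
  have hLc : Continuous fun p : ℝ × ℝ => (innerₗ ℝ) p.1 p.2 := continuous_inner
  have hFc : Continuous (𝓕⁻ m) := continuous_fourierInv hmi
  -- Inversion in weak form: writing φ = 𝓕 (𝓕⁻ φ), the outer transform is moved onto μ, producing m,
  -- and the inverse transform is then moved onto m.
  have htest : ∀ φ : 𝓢(ℝ, ℂ), ∫ y, φ y ∂μ = ∫ y, φ y * 𝓕⁻ m y := by
    intro φ
    have h1 : ∫ y, 𝓕 (𝓕⁻ φ) y ∂μ = ∫ x, (𝓕⁻ φ) x • m x := by
      have h := VectorFourier.integral_fourierIntegral_smul_eq_flip (μ := volume) (ν := μ)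
        (L := innerₗ ℝ) (f := (𝓕⁻ φ : 𝓢(ℝ, ℂ))) (g := fun _ => (1 : ℂ)) Real.continuous_fourierChar
        hLc (SchwartzMap.integrable _) (integrable_const _)
      simp only [smul_eq_mul, mul_one] at h
      rw [SchwartzMap.fourier_coe]
      refine h.trans (integral_congr_ae (ae_of_all _ fun x => ?_))
      simp only [smul_eq_mul]
      rw [hm]
      congr 1
      refine integral_congr_ae (ae_of_all _ fun y => ?_)
      simp only [LinearMap.flip_apply, innerₗ_apply_apply, Circle.smul_def, smul_eq_mul, mul_one,
        Real.fourierChar_apply]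
      congr 1
      simp
      ring
    rw [FourierTransform.fourier_fourierInv_eq] at h1
    rw [h1, SchwartzMap.fourierInv_coe]
    have h := VectorFourier.integral_fourierIntegral_smul_eq_flip (μ := volume) (ν := volume)
        (L := -innerₗ ℝ) (f := φ) (g := m) Real.continuous_fourierChar
        hLc.neg (SchwartzMap.integrable _) hmi
    have hflip : (-innerₗ ℝ : ℝ →ₗ[ℝ] ℝ →ₗ[ℝ] ℝ).flip = -innerₗ ℝ := by
      ext; simp
    rw [hflip] at h
    exact h
  set d : ℝ → ℝ := fun ξ => (𝓕⁻ m ξ).re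
  have hd : Continuous d := Complex.continuous_re.comp hFc
  have hreal : ∀ ψ : ℝ → ℝ, ContDiff ℝ ∞ ψ → HasCompactSupport ψ →
      ∫ y, ψ y ∂μ = ∫ y, ψ y * d y := by
    intro ψ h1 h2
    have hc1 : ContDiff ℝ ∞ (fun y => (ψ y : ℂ)) := Complex.ofRealCLM.contDiff.comp h1
    have hc2 : HasCompactSupport (fun y => (ψ y : ℂ)) := h2.comp_left Complex.ofReal_zero
    have h3 := htest (hc2.toSchwartzMap hc1)
    have h4 : ∀ y, hc2.toSchwartzMap hc1 y = (ψ y : ℂ) := fun y => rfl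
    simp_rw [h4] at h3
    have hi : Integrable (fun y => (ψ y : ℂ) * 𝓕⁻ m y) :=
      ((Complex.continuous_ofReal.comp h1.continuous).mul hFc).integrable_of_hasCompactSupport
        hc2.mul_right
    have h5 := congrArg Complex.re h3
    rw [integral_complex_ofReal, Complex.ofReal_re] at h5
    rw [h5]
    change RCLike.re (∫ y, (ψ y : ℂ) * 𝓕⁻ m y) = _
    rw [← integral_re hi]
    refine integral_congr_ae (ae_of_all _ fun y => ?_)
    simp [d]
  -- The sign of d is not yet known, so the identity is proved between positive measures, with the
  -- negative part of d added to μ.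
  have hdp : Continuous fun ξ => (d ξ).toNNReal := continuous_real_toNNReal.comp hd
  have hdn : Continuous fun ξ => (-d ξ).toNNReal := continuous_real_toNNReal.comp hd.neg
  have hlp : IsLocallyFiniteMeasure (volume.withDensity fun ξ => ((d ξ).toNNReal : ℝ≥0∞)) :=
    IsLocallyFiniteMeasure.withDensity_coe hdp
  have hln : IsLocallyFiniteMeasure (volume.withDensity fun ξ => ((-d ξ).toNNReal : ℝ≥0∞)) :=
    IsLocallyFiniteMeasure.withDensity_coe hdn
  have hadd : IsLocallyFiniteMeasure
      (μ + volume.withDensity fun ξ => ((-d ξ).toNNReal : ℝ≥0∞)) := by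
    refine ⟨fun y => ?_⟩
    obtain ⟨s, hs, hfin⟩ := (volume.withDensity fun ξ => ((-d ξ).toNNReal : ℝ≥0∞)).finiteAt_nhds y
    exact ⟨s, hs, ENNReal.add_lt_top.2 ⟨measure_lt_top μ s, hfin⟩⟩
  have hext : μ + volume.withDensity (fun ξ => ((-d ξ).toNNReal : ℝ≥0∞)) =
      volume.withDensity (fun ξ => ((d ξ).toNNReal : ℝ≥0∞)) := by
    refine measure_ext_of_integral_contDiff fun ψ h1 h2 => ?_
    have hc : ∀ (ρ : Measure ℝ) [IsLocallyFiniteMeasure ρ], Integrable ψ ρ := fun ρ _ =>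
      h1.continuous.integrable_of_hasCompactSupport h2
    rw [integral_add_measure (hc _) (hc _), hreal ψ h1 h2,
      integral_withDensity_eq_integral_smul hdn.measurable,
      integral_withDensity_eq_integral_smul hdp.measurable, ← integral_add]
    · refine integral_congr_ae (ae_of_all _ fun y => ?_)
      simp only [NNReal.smul_def, smul_eq_mul, Real.coe_toNNReal']
      rcases le_total 0 (d y) with h | h
      · rw [max_eq_left h, max_eq_right (by linarith)]; ring
      · rw [max_eq_right h, max_eq_left (by linarith)]; ring
    · exact (h1.continuous.mul hd).integrable_of_hasCompactSupport h2.mul_right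
    · exact ((NNReal.continuous_coe.comp hdn).mul h1.continuous).integrable_of_hasCompactSupport
        h2.mul_left
  -- On {d < 0} the right side of `hext` has no mass, hence neither has the negative part; off this
  -- set the negative part vanishes by definition.
  have hzero : volume.withDensity (fun ξ => ((-d ξ).toNNReal : ℝ≥0∞)) = 0 := by
    have hN : MeasurableSet {ξ | d ξ < 0} := measurableSet_lt hd.measurable measurable_const
    have h1 : volume.withDensity (fun ξ => ((-d ξ).toNNReal : ℝ≥0∞)) {ξ | d ξ < 0} = 0 := by
      refine le_antisymm ?_ zero_le
      calc _ ≤ (μ + volume.withDensity (fun ξ => ((-d ξ).toNNReal : ℝ≥0∞))) {ξ | d ξ < 0} :=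
            Measure.le_add_left le_rfl _
        _ = 0 := by
            rw [hext, withDensity_apply _ hN, setLIntegral_congr_fun hN (g := fun _ => 0)]
            · simp
            · intro ξ hξ
              simp [le_of_lt (show d ξ < 0 from hξ)]
    have h2 : volume.withDensity (fun ξ => ((-d ξ).toNNReal : ℝ≥0∞)) {ξ | d ξ < 0}ᶜ = 0 := by
      rw [withDensity_apply _ hN.compl, setLIntegral_congr_fun hN.compl (g := fun _ => 0)]
      · simp
      · intro ξ hξ
        have : 0 ≤ d ξ := not_lt.1 hξ
        simp [this]
    rw [← Measure.measure_univ_eq_zero, ← union_compl_self {ξ | d ξ < 0}]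
    exact measure_union_null h1 h2
  rw [hzero, add_zero] at hext
  refine ⟨hext, ?_⟩
  have hae := (withDensity_eq_zero_iff hdn.measurable.coe_nnreal_ennreal.aemeasurable).1 hzero
  filter_upwards [hae] with ξ hξ
  have h0 : (-d ξ).toNNReal = 0 := by simpa using hξ
  have h1 := Real.toNNReal_eq_zero.1 h0
  exact neg_nonpos.1 h1

end FourierInversion

/-! ### Dyadic chaining and Kolmogorov's criterion -/

section Chaining

open Filter Topology

/-- The `k`-th dyadic approximation from below of `s` in `[0, T]`. -/
noncomputable def dyadicFloor (T : ℝ) (k : ℕ) (s : ℝ) : ℝ := (⌊s * 2 ^ k / T⌋₊ : ℝ) * (T / 2 ^ k)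

lemma tendsto_dyadicFloor {T : ℝ} (hT : 0 < T) {s : ℝ} (hs : 0 ≤ s) :
    Tendsto (fun k => dyadicFloor T k s) atTop (𝓝 s) := by
  have h1 : Tendsto (fun k : ℕ => s - T * (1 / 2) ^ k) atTop (𝓝 s) := by
    have := (tendsto_pow_atTop_nhds_zero_of_lt_one (r := (1 / 2 : ℝ)) (by norm_num)
      (by norm_num)).const_mul T
    simpa using tendsto_const_nhds.sub this
  refine tendsto_of_tendsto_of_tendsto_of_le_of_le h1 tendsto_const_nhds (fun k => ?_) fun k => ?_
  · have h2 := (Nat.lt_floor_add_one (s * 2 ^ k / T)).le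
    rw [div_le_iff₀ hT] at h2
    simp only [dyadicFloor, one_div, inv_pow]
    field_simp
    linarith
  · have h2 := Nat.floor_le (a := s * 2 ^ k / T) (by positivity)
    rw [le_div_iff₀ hT] at h2
    simp only [dyadicFloor]
    rw [mul_div_assoc', div_le_iff₀ (by positivity)]
    exact h2

variable {q : ℝ → ℝ → ℝ≥0∞} {T : ℝ} {C ρ r : ℝ≥0∞}

lemma dyadic_adjacent_le (hself : ∀ s, q s s = 0)
    (hdy : ∀ k i : ℕ, i < 2 ^ k → q (i * (T / 2 ^ k)) ((i + 1) * (T / 2 ^ k)) ≤ C * (r * ρ ^ k))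
    {k i j : ℕ} (hij : j = i ∨ j = i + 1) (hj : j ≤ 2 ^ k) :
    q (i * (T / 2 ^ k)) (j * (T / 2 ^ k)) ≤ C * (r * ρ ^ k) := by
  rcases hij with rfl | rfl
  · rw [hself]; exact zero_le
  · push_cast
    exact hdy k i (by omega)

lemma floor_mul_two_pow_le (hT : 0 < T) {s : ℝ} (hs : s ≤ T) (k : ℕ) :
    ⌊s * 2 ^ k / T⌋₊ ≤ 2 ^ k := by
  have h : s * 2 ^ k / T ≤ ((2 ^ k : ℕ) : ℝ) := by
    rw [div_le_iff₀ hT]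
    push_cast
    rw [mul_comm]
    gcongr
  exact Nat.floor_le_of_le h

/-- Since ⌊2x⌋ is 2⌊x⌋ or 2⌊x⌋ + 1, consecutive approximations are equal or adjacent at the finer
level. -/
lemma dyadicFloor_succ_le (hT : 0 < T) (hself : ∀ s, q s s = 0)
    (hdy : ∀ k i : ℕ, i < 2 ^ k → q (i * (T / 2 ^ k)) ((i + 1) * (T / 2 ^ k)) ≤ C * (r * ρ ^ k))
    {s : ℝ} (hs0 : 0 ≤ s) (hs : s ≤ T) (k : ℕ) :
    q (dyadicFloor T k s) (dyadicFloor T (k + 1) s) ≤ C * (r * ρ ^ (k + 1)) := by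
  set x := s * 2 ^ k / T
  have hx : 0 ≤ x := by positivity
  have h2 : s * 2 ^ (k + 1) / T = 2 * x := by simp only [x, pow_succ]; ring
  have h3 : dyadicFloor T k s = ((2 * ⌊x⌋₊ : ℕ) : ℝ) * (T / 2 ^ (k + 1)) := by
    simp only [dyadicFloor, x, pow_succ]
    push_cast
    field_simp
  rw [h3, dyadicFloor, h2]
  refine dyadic_adjacent_le hself hdy ?_ (by rw [← h2]; exact floor_mul_two_pow_le hT hs _)
  have h4 := Nat.floor_le hx
  have h5 := Nat.lt_floor_add_one x
  have h6 : 2 * ⌊x⌋₊ ≤ ⌊2 * x⌋₊ := Nat.le_floor (by push_cast; linarith)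
  have h7 : ⌊2 * x⌋₊ < 2 * ⌊x⌋₊ + 2 := (Nat.floor_lt (by positivity)).2 (by push_cast; linarith)
  omega

lemma dyadicFloor_add_le (hT : 0 < T) (hself : ∀ s, q s s = 0)
    (htri : ∀ a b c, q a c ≤ q a b + q b c)
    (hdy : ∀ k i : ℕ, i < 2 ^ k → q (i * (T / 2 ^ k)) ((i + 1) * (T / 2 ^ k)) ≤ C * (r * ρ ^ k))
    {s : ℝ} (hs0 : 0 ≤ s) (hs : s ≤ T) (k n : ℕ) :
    q (dyadicFloor T k s) (dyadicFloor T (k + n) s) ≤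
      C * (r * ρ ^ k) * ∑ j ∈ Finset.range n, ρ ^ (j + 1) := by
  induction n with
  | zero => simp [hself]
  | succ n ih =>
    refine (htri _ (dyadicFloor T (k + n) s) _).trans ?_
    rw [Finset.sum_range_succ, mul_add]
    refine add_le_add ih ((dyadicFloor_succ_le hT hself hdy hs0 hs (k + n)).trans_eq ?_)
    rw [add_assoc, pow_add]
    ring

/-- Chaining along dyadic points. -/
lemma le_of_dyadic_le (hT : 0 < T) {α : ℝ} (hα : 0 < α) (hself : ∀ s, q s s = 0)
    (hsymm : ∀ a b, q a b = q b a) (htri : ∀ a b c, q a c ≤ q a b + q b c)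
    (hlsc : ∀ (s t : ℝ) (a b : ℕ → ℝ), Tendsto a atTop (𝓝 s) → Tendsto b atTop (𝓝 t) →
      q s t ≤ liminf (fun n => q (a n) (b n)) atTop)
    (hdy : ∀ k i : ℕ, i < 2 ^ k → q (i * (T / 2 ^ k)) ((i + 1) * (T / 2 ^ k)) ≤
      C * ENNReal.ofReal ((T / 2 ^ k) ^ α)) {s t : ℝ} (hs : s ∈ Icc 0 T) (ht : t ∈ Icc 0 T) :
    q s t ≤ C * (ENNReal.ofReal (2 ^ α) * (1 + 2 * (1 - ENNReal.ofReal (2 ^ (-α)))⁻¹)) *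
      ENNReal.ofReal (|t - s| ^ α) := by
  wlog hst : s < t generalizing s t with H
  · rcases eq_or_lt_of_le (not_lt.1 hst) with h | h
    · subst h; rw [hself]; exact zero_le
    · rw [hsymm, abs_sub_comm]; exact H ht hs h
  set ρ := ENNReal.ofReal (2 ^ (-α))
  have hpow : ∀ k : ℕ, ENNReal.ofReal ((T / 2 ^ k) ^ α) = ENNReal.ofReal (T ^ α) * ρ ^ k := by
    intro k
    rw [← ENNReal.ofReal_pow (by positivity), ← ENNReal.ofReal_mul (by positivity),
      Real.div_rpow hT.le (by positivity), ← Real.rpow_natCast 2 k, ← Real.rpow_mul (by norm_num),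
      ← Real.rpow_mul_natCast (by norm_num), div_eq_mul_inv, ← Real.rpow_neg (by norm_num)]
    congr 3
    ring
  simp_rw [hpow] at hdy
  rw [abs_of_pos (sub_pos.2 hst)]
  -- The level k satisfies T/2^(k+1) < t - s ≤ T/2^k. Thus s and t have equal or adjacent
  -- approximations at level k, and the mesh is at most 2(t-s), whence the factor 2^α.
  obtain ⟨k, hk1, hk2⟩ := exists_nat_pow_near_of_lt_one (x := (t - s) / T) (y := 1 / 2)
    (div_pos (sub_pos.2 hst) hT) (by rw [div_le_one hT]; linarith [ht.2, hs.1]) (by norm_num)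
    (by norm_num)
  have hk2' : t - s ≤ T / 2 ^ k := by
    rw [div_le_iff₀ hT] at hk2
    calc t - s ≤ (1 / 2) ^ k * T := hk2
      _ = T / 2 ^ k := by rw [one_div, inv_pow]; ring
  have hk1' : T / 2 ^ k ≤ 2 * (t - s) := by
    rw [lt_div_iff₀ hT] at hk1
    calc T / 2 ^ k = 2 * ((1 / 2) ^ (k + 1) * T) := by rw [one_div, inv_pow, pow_succ]; field_simp
      _ ≤ _ := by linarith
  have hgeom : ∀ n : ℕ, ∑ j ∈ Finset.range n, ρ ^ (j + 1) ≤ (1 - ρ)⁻¹ := by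
    intro n
    rw [← ENNReal.tsum_geometric]
    calc ∑ j ∈ Finset.range n, ρ ^ (j + 1) ≤ ∑' j, ρ ^ (j + 1) := ENNReal.sum_le_tsum _
      _ ≤ ∑' j, ρ ^ j := ENNReal.tsum_comp_le_tsum_of_injective (add_left_injective 1) fun j => ρ ^ j
  have hmid : q (dyadicFloor T k s) (dyadicFloor T k t) ≤ C * (ENNReal.ofReal (T ^ α) * ρ ^ k) := by
    refine dyadic_adjacent_le hself hdy ?_ (floor_mul_two_pow_le hT ht.2 k)
    have h1 : s * 2 ^ k / T ≤ t * 2 ^ k / T := by gcongr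
    have h2 : t * 2 ^ k / T ≤ s * 2 ^ k / T + 1 := by
      rw [le_div_iff₀ (by positivity)] at hk2'
      rw [div_add_one hT.ne', div_le_div_iff_of_pos_right hT]
      linarith
    have h3 := Nat.floor_le_floor h1
    have h4 := Nat.floor_le_floor h2
    have h0 : 0 ≤ s * 2 ^ k / T := by have := hs.1; positivity
    rw [Nat.floor_add_one h0] at h4
    omega
  -- The chain goes from the fine approximation of s to level k, across, and back to the fine
  -- approximation of t: one adjacent step and two geometric series.
  have hall : ∀ n, q (dyadicFloor T (k + n) s) (dyadicFloor T (k + n) t) ≤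
      C * (ENNReal.ofReal (T ^ α) * ρ ^ k) * (1 + 2 * (1 - ρ)⁻¹) := by
    intro n
    have hb : ∀ y ∈ Icc 0 T, q (dyadicFloor T k y) (dyadicFloor T (k + n) y) ≤
        C * (ENNReal.ofReal (T ^ α) * ρ ^ k) * (1 - ρ)⁻¹ := fun y hy =>
      (dyadicFloor_add_le hT hself htri hdy hy.1 hy.2 k n).trans (by gcongr; exact hgeom n)
    calc _ ≤ q (dyadicFloor T (k + n) s) (dyadicFloor T k s) +
          (q (dyadicFloor T k s) (dyadicFloor T k t) +
            q (dyadicFloor T k t) (dyadicFloor T (k + n) t)) :=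
          (htri _ (dyadicFloor T k s) _).trans (by gcongr; exact htri _ _ _)
      _ ≤ C * (ENNReal.ofReal (T ^ α) * ρ ^ k) * (1 - ρ)⁻¹ +
          (C * (ENNReal.ofReal (T ^ α) * ρ ^ k) + C * (ENNReal.ofReal (T ^ α) * ρ ^ k) * (1 - ρ)⁻¹) := by
          gcongr
          · rw [hsymm]; exact hb s hs
          · exact hb t ht
      _ = _ := by ring
  have hlim := hlsc s t (fun n => dyadicFloor T (k + n) s) (fun n => dyadicFloor T (k + n) t)
    ((tendsto_dyadicFloor hT hs.1).comp (tendsto_add_atTop_nat k |>.congr fun n => add_comm _ _))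
    ((tendsto_dyadicFloor hT ht.1).comp (tendsto_add_atTop_nat k |>.congr fun n => add_comm _ _))
  refine hlim.trans ((liminf_le_liminf (Eventually.of_forall hall)).trans ?_)
  rw [liminf_const]
  have hfin : ENNReal.ofReal (T ^ α) * ρ ^ k ≤
      ENNReal.ofReal (2 ^ α) * ENNReal.ofReal ((t - s) ^ α) := by
    rw [← hpow, ← ENNReal.ofReal_mul (by positivity), ← Real.mul_rpow (by norm_num)
      (sub_pos.2 hst).le]
    gcongr
  calc _ ≤ C * (ENNReal.ofReal (2 ^ α) * ENNReal.ofReal ((t - s) ^ α)) * (1 + 2 * (1 - ρ)⁻¹) := by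
        gcongr
    _ = _ := by ring

variable {Ω : Type*} [MeasurableSpace Ω] {P : Measure Ω}

/-- Kolmogorov's continuity criterion for a random lower semicontinuous pseudodistance. -/
lemma exists_holder_of_moment (hT : 0 < T) {α β : ℝ} (hα : 0 < α) {p : ℕ} (hp : p ≠ 0)
    (hβ : 1 + α * p < β) {Q : Ω → ℝ → ℝ → ℝ≥0∞} (hQm : ∀ s t, Measurable fun ω => Q ω s t)
    (hself : ∀ ω s, Q ω s s = 0) (hsymm : ∀ ω a b, Q ω a b = Q ω b a)
    (htri : ∀ ω a b c, Q ω a c ≤ Q ω a b + Q ω b c)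
    (hlsc : ∀ ω (s t : ℝ) (a b : ℕ → ℝ), Tendsto a atTop (𝓝 s) → Tendsto b atTop (𝓝 t) →
      Q ω s t ≤ liminf (fun n => Q ω (a n) (b n)) atTop) {K : ℝ≥0∞} (hK : K ≠ ⊤)
    (hmom : ∀ s t, 0 ≤ s → s ≤ t → t ≤ T →
      ∫⁻ ω, Q ω s t ^ p ∂P ≤ K * ENNReal.ofReal ((t - s) ^ β)) :
    ∃ C : Ω → ℝ≥0∞, Measurable C ∧ (∀ᵐ ω ∂P, C ω < ⊤) ∧ ∀ ω, ∀ s ∈ Icc 0 T, ∀ t ∈ Icc 0 T,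
      Q ω s t ≤ C ω * ENNReal.ofReal (|t - s| ^ α) := by
  set R : ℕ → ℝ≥0∞ := fun k => ENNReal.ofReal ((T / 2 ^ k) ^ α)
  have hR0 : ∀ k, R k ≠ 0 := fun k => by
    simp only [R, ne_eq, ENNReal.ofReal_eq_zero, not_le]; positivity
  have hRt : ∀ k, R k ≠ ⊤ := fun k => ENNReal.ofReal_ne_top
  -- S collects the p-th powers of all normalised dyadic increments, so S^(1/p) bounds each of them.
  -- Its mean is dominated by a geometric series of ratio 2^(1-(β-αp)), which is less than 1 by
  -- `hβ`.
  set S : Ω → ℝ≥0∞ := fun ω => ∑' k : ℕ, ∑ i ∈ Finset.range (2 ^ k),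
    (Q ω (i * (T / 2 ^ k)) ((i + 1) * (T / 2 ^ k)) / R k) ^ p
  have hSm : Measurable S := Measurable.tsum fun k =>
    Finset.measurable_fun_sum _ fun i _ => ((hQm _ _).div_const _).pow_const _
  set M : ℝ≥0∞ := ENNReal.ofReal (2 ^ α) * (1 + 2 * (1 - ENNReal.ofReal (2 ^ (-α)))⁻¹)
  have hM : M ≠ ⊤ := by
    refine ENNReal.mul_ne_top ENNReal.ofReal_ne_top (ENNReal.add_ne_top.2 ⟨by simp,
      ENNReal.mul_ne_top (by simp) (ENNReal.inv_ne_top.2 ?_)⟩)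
    refine (tsub_pos_of_lt ?_).ne'
    exact ENNReal.ofReal_lt_one.2 (Real.rpow_lt_one_of_one_lt_of_neg (by norm_num) (by linarith))
  have hSi : ∫⁻ ω, S ω ∂P < ⊤ := by
    have h1 : ∀ k : ℕ, ∫⁻ ω, ∑ i ∈ Finset.range (2 ^ k),
        (Q ω (i * (T / 2 ^ k)) ((i + 1) * (T / 2 ^ k)) / R k) ^ p ∂P ≤
        K * ENNReal.ofReal (T ^ (β - α * p)) * ENNReal.ofReal (2 ^ (1 - (β - α * p))) ^ k := by
      intro k
      rw [lintegral_finsetSum _ fun i _ => ((hQm _ _).div_const _).pow_const _]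
      have h2 : ∀ i ∈ Finset.range (2 ^ k),
          ∫⁻ ω, (Q ω (i * (T / 2 ^ k)) ((i + 1) * (T / 2 ^ k)) / R k) ^ p ∂P ≤
          K * ENNReal.ofReal ((T / 2 ^ k) ^ (β - α * p)) := by
        intro i hi
        have hi' : ((i : ℝ) + 1) ≤ 2 ^ k := by exact_mod_cast Finset.mem_range.1 hi
        have h3 := hmom (i * (T / 2 ^ k)) ((i + 1) * (T / 2 ^ k)) (by positivity)
          (by gcongr; linarith) (by
            calc ((i : ℝ) + 1) * (T / 2 ^ k) ≤ 2 ^ k * (T / 2 ^ k) := by gcongr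
              _ = T := by field_simp)
        have h4 : ((i : ℝ) + 1) * (T / 2 ^ k) - i * (T / 2 ^ k) = T / 2 ^ k := by ring
        rw [h4] at h3
        have hx : 0 < T / 2 ^ k := by positivity
        simp_rw [div_eq_mul_inv, mul_pow]
        rw [lintegral_mul_const _ ((hQm _ _).pow_const _)]
        calc _ ≤ K * ENNReal.ofReal ((T / 2 ^ k) ^ β) * (R k)⁻¹ ^ p := by
              gcongr
              simpa only [div_eq_mul_inv] using h3
          _ = K * ENNReal.ofReal ((T / 2 ^ k) ^ (β - α * p)) := by
              rw [← ENNReal.inv_pow, mul_assoc, ← div_eq_mul_inv, ← ENNReal.ofReal_pow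
                (by positivity), ← ENNReal.ofReal_div_of_pos (by positivity),
                ← Real.rpow_mul_natCast hx.le, ← Real.rpow_sub hx]
      refine (Finset.sum_le_sum h2).trans_eq ?_
      rw [Finset.sum_const, Finset.card_range, nsmul_eq_mul, mul_left_comm, mul_assoc]
      congr 1
      have h3 : (2 : ℝ) ^ k * (T / 2 ^ k) ^ (β - α * p) =
          T ^ (β - α * p) * (2 ^ (1 - (β - α * p))) ^ k := by
        have h4 : ((2 : ℝ) ^ k) ^ (β - α * p) = (2 ^ (β - α * p)) ^ k := by
          rw [← Real.rpow_natCast, ← Real.rpow_natCast, ← Real.rpow_mul (by norm_num),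
            ← Real.rpow_mul (by norm_num), mul_comm]
        rw [Real.div_rpow hT.le (by positivity), h4, Real.rpow_sub (by norm_num) 1, Real.rpow_one,
          div_pow]
        ring
      rw [← ENNReal.ofReal_natCast, ← ENNReal.ofReal_mul (by positivity), Nat.cast_pow,
        Nat.cast_ofNat, h3, ENNReal.ofReal_mul (by positivity), ENNReal.ofReal_pow (by positivity)]
    rw [lintegral_tsum fun k => (Finset.measurable_fun_sum _ fun i _ =>
      ((hQm _ _).div_const _).pow_const _).aemeasurable]
    refine (ENNReal.tsum_le_tsum h1).trans_lt ?_
    rw [ENNReal.tsum_mul_left, ENNReal.tsum_geometric]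
    refine ENNReal.mul_lt_top (ENNReal.mul_lt_top hK.lt_top ENNReal.ofReal_lt_top)
      (ENNReal.inv_lt_top.2 (tsub_pos_of_lt ?_))
    exact ENNReal.ofReal_lt_one.2 (Real.rpow_lt_one_of_one_lt_of_neg (by norm_num) (by linarith))
  refine ⟨fun ω => S ω ^ (p : ℝ)⁻¹ * M, (hSm.pow_const _).mul_const _, ?_, ?_⟩
  · filter_upwards [ae_lt_top hSm hSi.ne] with ω hω
    exact ENNReal.mul_lt_top (ENNReal.rpow_lt_top_of_nonneg (by positivity) hω.ne) hM.lt_top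
  · intro ω s hs t ht
    refine le_of_dyadic_le hT hα (hself ω) (hsymm ω) (htri ω) (hlsc ω) ?_ hs ht
    intro k i hi
    have h1 : (Q ω (i * (T / 2 ^ k)) ((i + 1) * (T / 2 ^ k)) / R k) ^ p ≤ S ω := by
      refine le_trans ?_ (ENNReal.le_tsum k)
      exact Finset.single_le_sum (f := fun i : ℕ =>
        (Q ω (i * (T / 2 ^ k)) ((i + 1) * (T / 2 ^ k)) / R k) ^ p) (fun _ _ => zero_le)
        (Finset.mem_range.2 hi)
    have h2 : Q ω (i * (T / 2 ^ k)) ((i + 1) * (T / 2 ^ k)) / R k ≤ S ω ^ (p : ℝ)⁻¹ := by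
      rw [ENNReal.le_rpow_inv_iff (by positivity), ENNReal.rpow_natCast]
      exact h1
    exact (ENNReal.div_le_iff (hR0 k) (hRt k)).1 h2

end Chaining

/-! ### A weighted Jensen inequality -/

section WeightedJensen

/-- Jensen's inequality with a weight. -/
lemma lintegral_pow_le_weighted {α : Type*} [MeasurableSpace α] {μ : Measure α} {F w : α → ℝ≥0∞}
    (hF : AEMeasurable F μ) (hw : AEMeasurable w μ) (hw0 : ∀ x, w x ≠ 0) (hwt : ∀ x, w x ≠ ⊤)
    {p : ℕ} (hp : p ≠ 0) :
    (∫⁻ x, F x ∂μ) ^ p ≤ (∫⁻ x, w x ∂μ) ^ (p - 1) * ∫⁻ x, F x ^ p * (w x)⁻¹ ^ (p - 1) ∂μ := by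
  have hp1 : (1 : ℝ) ≤ p := by exact_mod_cast Nat.one_le_iff_ne_zero.2 hp
  have hp0 : (0 : ℝ) < p := by linarith
  have hinv : (p : ℝ)⁻¹ ≤ 1 := inv_le_one_of_one_le₀ hp1
  have hcast : ((p - 1 : ℕ) : ℝ) * (p : ℝ)⁻¹ = 1 - (p : ℝ)⁻¹ := by
    rw [Nat.cast_sub (Nat.one_le_iff_ne_zero.2 hp), Nat.cast_one]
    field_simp
  -- This factorisation prepares Hölder's inequality with weights 1 - 1/p and 1/p.
  have hpt : ∀ x, F x = w x ^ (1 - (p : ℝ)⁻¹) * (F x ^ p * (w x)⁻¹ ^ (p - 1)) ^ (p : ℝ)⁻¹ := by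
    intro x
    rw [ENNReal.mul_rpow_of_nonneg _ _ (by positivity), ← ENNReal.rpow_natCast,
      ← ENNReal.rpow_natCast, ← ENNReal.rpow_mul, ← ENNReal.rpow_mul, mul_inv_cancel₀ hp0.ne',
      ENNReal.rpow_one, hcast, mul_left_comm, ENNReal.inv_rpow, ENNReal.mul_inv_cancel, mul_one]
    · exact (ENNReal.rpow_pos (pos_iff_ne_zero.2 (hw0 x)) (hwt x)).ne'
    · exact ENNReal.rpow_ne_top_of_nonneg (by linarith) (hwt x)
  have h := ENNReal.lintegral_mul_norm_pow_le hw
    ((hF.pow_const p).mul ((hw.inv).pow_const (p - 1))) (p := 1 - (p : ℝ)⁻¹) (q := (p : ℝ)⁻¹)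
    (by linarith) (by positivity) (by ring)
  have h2 : ∫⁻ x, F x ∂μ ≤ (∫⁻ x, w x ∂μ) ^ (1 - (p : ℝ)⁻¹) *
      (∫⁻ x, F x ^ p * (w x)⁻¹ ^ (p - 1) ∂μ) ^ (p : ℝ)⁻¹ :=
    (lintegral_congr hpt).trans_le h
  calc (∫⁻ x, F x ∂μ) ^ p ≤ ((∫⁻ x, w x ∂μ) ^ (1 - (p : ℝ)⁻¹) *
      (∫⁻ x, F x ^ p * (w x)⁻¹ ^ (p - 1) ∂μ) ^ (p : ℝ)⁻¹) ^ p := by gcongr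
    _ = _ := by
      rw [mul_pow, ← ENNReal.rpow_mul_natCast, ← ENNReal.rpow_mul_natCast,
        inv_mul_cancel₀ hp0.ne', ENNReal.rpow_one, ← hcast, mul_assoc, inv_mul_cancel₀ hp0.ne',
        mul_one, ENNReal.rpow_natCast]

end WeightedJensen

/-! ### The Fourier transform of an occupation measure -/

section PathFourier

open Filter Topology

/-- The Fourier transform at frequency `θ` of the occupation measure of the path `f` on `(s, t]`. -/
noncomputable def pathFourier (f : ℝ → ℝ) (s t θ : ℝ) : ℂ :=
  ∫ q in s..t, Complex.exp (-(2 * Real.pi * θ * f q) * Complex.I)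

/-- The `L¹` norm of the Fourier transform of the occupation measure of `f` on `(s, t]`. -/
noncomputable def pathFourierNorm (f : ℝ → ℝ) (s t : ℝ) : ℝ≥0∞ :=
  ∫⁻ θ, ‖pathFourier f s t θ‖ₑ

variable {f : ℝ → ℝ}

lemma norm_cexp_path (y θ : ℝ) : ‖Complex.exp (-(2 * Real.pi * θ * y) * Complex.I)‖ = 1 := by
  have : (-(2 * Real.pi * θ * y) : ℂ) = ((-(2 * Real.pi * θ * y) : ℝ) : ℂ) := by push_cast; ring
  rw [this, Complex.norm_exp_ofReal_mul_I]

lemma intervalIntegrable_cexp_path (hf : Measurable f) (θ s t : ℝ) :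
    IntervalIntegrable (fun q => Complex.exp (-(2 * Real.pi * θ * f q) * Complex.I)) volume s t := by
  refine (intervalIntegrable_const (c := (1 : ℝ))).mono_fun ?_ (ae_of_all _ fun q => ?_)
  · exact Measurable.aestronglyMeasurable (by fun_prop)
  · exact (norm_cexp_path (f q) θ).le.trans (by simp)

lemma pathFourier_self (s θ : ℝ) : pathFourier f s s θ = 0 := intervalIntegral.integral_same

lemma pathFourier_symm (s t θ : ℝ) : pathFourier f s t θ = -pathFourier f t s θ :=
  intervalIntegral.integral_symm _ _

lemma pathFourier_add (hf : Measurable f) (a b c θ : ℝ) :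
    pathFourier f a b θ + pathFourier f b c θ = pathFourier f a c θ :=
  intervalIntegral.integral_add_adjacent_intervals (intervalIntegrable_cexp_path hf θ a b)
    (intervalIntegrable_cexp_path hf θ b c)

lemma pathFourier_sub (hf : Measurable f) (s t θ : ℝ) :
    pathFourier f s t θ = pathFourier f 0 t θ - pathFourier f 0 s θ := by
  rw [← pathFourier_add hf 0 s t]; ring

lemma norm_pathFourier_le {s t : ℝ} (hst : s ≤ t) (θ : ℝ) : ‖pathFourier f s t θ‖ ≤ t - s := by
  have := intervalIntegral.norm_integral_le_of_norm_le_const (a := s) (b := t) (C := 1)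
    (f := fun q => Complex.exp (-(2 * Real.pi * θ * f q) * Complex.I))
    (fun q _ => (norm_cexp_path _ _).le)
  rwa [one_mul, abs_of_nonneg (sub_nonneg.2 hst)] at this

lemma continuous_pathFourier_right (hf : Measurable f) (θ : ℝ) :
    Continuous fun t => pathFourier f 0 t θ :=
  intervalIntegral.continuous_primitive (fun _ _ => intervalIntegrable_cexp_path hf θ _ _) 0

variable {Ω : Type*} [MeasurableSpace Ω] {v : Ω → ℝ → ℝ}

lemma measurable_pathFourier_prod (hv : Measurable (Function.uncurry v)) (s t : ℝ) :
    Measurable fun p : Ω × ℝ => pathFourier (v p.1) s t p.2 := by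
  have h : Measurable (Function.uncurry fun (p : Ω × ℝ) q =>
      Complex.exp (-(2 * Real.pi * p.2 * v p.1 q) * Complex.I)) := by
    have h1 : Measurable fun z : (Ω × ℝ) × ℝ => v z.1.1 z.2 :=
      hv.comp ((measurable_fst.comp measurable_fst).prodMk measurable_snd)
    have h2 : Measurable fun z : (Ω × ℝ) × ℝ => ((v z.1.1 z.2 : ℝ) : ℂ) :=
      Complex.measurable_ofReal.comp h1
    have h3 : Measurable fun z : (Ω × ℝ) × ℝ => ((z.1.2 : ℝ) : ℂ) :=
      Complex.measurable_ofReal.comp (measurable_snd.comp measurable_fst)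
    exact Complex.measurable_exp.comp (((h3.const_mul _).mul h2).neg.mul_const _)
  exact measurable_intervalIntegral h s t

lemma measurable_pathFourier (hf : Measurable f) (s t : ℝ) : Measurable (pathFourier f s t) := by
  have h : Measurable (Function.uncurry fun (_ : Unit) θ => pathFourier f s t θ) :=
    measurable_pathFourier_prod (v := fun (_ : Unit) => f) (hf.comp measurable_snd) s t
  exact h.of_uncurry_left (x := ())

lemma measurable_pathFourierNorm (hv : Measurable (Function.uncurry v)) (s t : ℝ) :
    Measurable fun ω => pathFourierNorm (v ω) s t :=
  (measurable_pathFourier_prod hv s t).enorm.lintegral_prod_right'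

lemma pathFourierNorm_self (s : ℝ) : pathFourierNorm f s s = 0 := by
  simp [pathFourierNorm, pathFourier_self]

lemma pathFourierNorm_symm (s t : ℝ) : pathFourierNorm f s t = pathFourierNorm f t s := by
  refine lintegral_congr fun θ => ?_
  rw [pathFourier_symm, enorm_neg]

lemma pathFourierNorm_triangle (hf : Measurable f) (a b c : ℝ) :
    pathFourierNorm f a c ≤ pathFourierNorm f a b + pathFourierNorm f b c := by
  unfold pathFourierNorm
  rw [← lintegral_add_left (measurable_pathFourier hf a b).enorm]
  refine lintegral_mono fun θ => ?_
  rw [← pathFourier_add hf a b c]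
  exact enorm_add_le _ _

/-- For each θ the transform is continuous in the endpoints, so Fatou's lemma applies. Lower
semicontinuity is all that chaining requires, and it makes sense before the norm is known to be
finite. -/
lemma pathFourierNorm_le_liminf (hf : Measurable f) {s t : ℝ} {a b : ℕ → ℝ}
    (ha : Tendsto a atTop (𝓝 s)) (hb : Tendsto b atTop (𝓝 t)) :
    pathFourierNorm f s t ≤ liminf (fun n => pathFourierNorm f (a n) (b n)) atTop := by
  refine le_trans (lintegral_mono fun θ => ?_)
    (lintegral_liminf_le fun n => (measurable_pathFourier hf (a n) (b n)).enorm)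
  refine (Tendsto.liminf_eq ?_).ge
  rw [pathFourier_sub hf s t θ]
  refine Tendsto.congr (fun n => by rw [pathFourier_sub hf (a n) (b n) θ]) ?_
  exact ((((continuous_pathFourier_right hf θ).tendsto t).comp hb).sub
    (((continuous_pathFourier_right hf θ).tendsto s).comp ha)).enorm

/-- Real and imaginary parts are cosine integrals with phases 0 and π/2, because cos(y+π/2) = -sin
y; the moment bound for cosines then serves both. -/
lemma norm_pathFourier_sq (hf : Measurable f) (s t θ : ℝ) :
    ‖pathFourier f s t θ‖ ^ 2 =
      (∫ q in s..t, Real.cos (2 * Real.pi * θ * f q + 0)) ^ 2 +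
      (∫ q in s..t, Real.cos (2 * Real.pi * θ * f q + Real.pi / 2)) ^ 2 := by
  have hi := intervalIntegrable_cexp_path hf θ s t
  have hform : ∀ q, (-(2 * Real.pi * θ * f q) * Complex.I : ℂ) =
      ((-(2 * Real.pi * θ * f q) : ℝ) : ℂ) * Complex.I := fun q => by push_cast; ring
  have hre : (pathFourier f s t θ).re = ∫ q in s..t, Real.cos (2 * Real.pi * θ * f q + 0) := by
    have := Complex.reCLM.intervalIntegral_comp_comm hi
    rw [pathFourier, ← Complex.reCLM_apply, ← this]
    refine intervalIntegral.integral_congr fun q _ => ?_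
    simp only [Complex.reCLM_apply]
    rw [hform, Complex.exp_ofReal_mul_I_re, Real.cos_neg, add_zero]
  have him : (pathFourier f s t θ).im =
      ∫ q in s..t, Real.cos (2 * Real.pi * θ * f q + Real.pi / 2) := by
    have := Complex.imCLM.intervalIntegral_comp_comm hi
    rw [pathFourier, ← Complex.imCLM_apply, ← this]
    refine intervalIntegral.integral_congr fun q _ => ?_
    simp only [Complex.imCLM_apply]
    rw [hform, Complex.exp_ofReal_mul_I_im, Real.sin_neg, Real.cos_add_pi_div_two]
  rw [Complex.sq_norm, Complex.normSq_apply, hre, him]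
  ring

end PathFourier

/-! ### Moments of the Fourier transform and of its `L¹` norm -/

section PathFourierMoments

variable {Ω : Type*} [MeasurableSpace Ω] {P : Measure Ω} [IsProbabilityMeasure P]
  {W : ℝ≥0 → BoundedBorel → Ω → ℝ}

lemma integrable_runningIntegral_pow {g : Ω → ℝ → ℝ} (hg : Measurable (Function.uncurry g))
    (hb : ∀ ω q, |g ω q| ≤ 1) {s t : ℝ} (hst : s ≤ t) (n : ℕ) :
    Integrable (fun ω => (∫ q in s..t, g ω q) ^ n) P := by
  refine Integrable.of_bound (C := (t - s) ^ n)
    ((measurable_intervalIntegral hg s t).pow_const n).aestronglyMeasurable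
    (ae_of_all _ fun ω => ?_)
  rw [Real.norm_eq_abs, abs_pow]
  exact pow_le_pow_left₀ (abs_nonneg _) (abs_intervalIntegral_le_of_abs_le_one (hb ω) hst) n

/-- Moments of the Fourier transform of the occupation measure of the solution. -/
lemma IsMildSolution.exists_lintegral_pathFourier_pow_le (hW : IsWhiteNoise P W)
    (hWm : ∀ t A, Measurable (W t A)) {u : ℝ → ℝ → Ω → ℝ} (hu : IsMildSolution P W u)
    {T x : ℝ} {v : Ω → ℝ → ℝ} (hv : Measurable (Function.uncurry v))
    (hvu : ∀ᵐ t, t ∈ Icc 0 T → (fun ω => v ω t) =ᵐ[P] u t x) {γ : ℝ} (hγ : 0 < γ) (hγ1 : γ < 1)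
    (n : ℕ) :
    ∃ D : ℝ, 0 ≤ D ∧ ∀ θ s t : ℝ, 0 ≤ s → s ≤ t → t ≤ T →
      ∫⁻ ω, ‖pathFourier (v ω) s t θ‖ₑ ^ (2 * n) ∂P ≤
        ENNReal.ofReal (D * ((1 + θ ^ 2) ^ (-γ)) ^ (2 * n) * (t - s) ^ (n * (2 - γ))) := by
  set K : ℝ := Real.exp ((4 * √Real.pi)⁻¹ * √T) * ((4 * √Real.pi)⁻¹ / (2 * γ)) ^ (-(2 * γ))
  have hK : 0 ≤ K := by positivity
  have h1γ : 0 < 1 - γ := by linarith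
  -- The power 2^(n-1) comes from convexity of the n-th power applied to the sum of two squares, the
  -- next factor 2 from the two phases.
  refine ⟨2 ^ (n - 1) * (2 * ((2 * n).factorial * (K / (1 - γ)) ^ n)), by positivity, ?_⟩
  intro θ s t hs hst ht
  have hvm : ∀ ω, Measurable (v ω) := fun ω => hv.of_uncurry_left
  have hg : ∀ φ, Measurable (Function.uncurry fun ω q => Real.cos (2 * Real.pi * θ * v ω q + φ)) :=
    fun φ => Real.measurable_cos.comp ((hv.const_mul _).add_const φ)
  have hint : ∀ φ, Integrable
      (fun ω => (∫ q in s..t, Real.cos (2 * Real.pi * θ * v ω q + φ)) ^ (2 * n)) P := fun φ =>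
    integrable_runningIntegral_pow (hg φ) (fun _ _ => Real.abs_cos_le_one _) hst _
  have hm : Measurable fun ω => pathFourier (v ω) s t θ :=
    Measurable.of_uncurry_right (f := fun ω θ => pathFourier (v ω) s t θ)
      (measurable_pathFourier_prod hv s t)
  have hmi : Integrable (fun ω => ‖pathFourier (v ω) s t θ‖ ^ (2 * n)) P := by
    refine Integrable.of_bound (C := (t - s) ^ (2 * n)) (hm.norm.pow_const _).aestronglyMeasurable
      (ae_of_all _ fun ω => ?_)
    rw [norm_pow, norm_norm]
    exact pow_le_pow_left₀ (norm_nonneg _) (norm_pathFourier_le hst θ) _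
  have hbound : ∀ φ, ∫ ω, (∫ q in s..t, Real.cos (2 * Real.pi * θ * v ω q + φ)) ^ (2 * n) ∂P ≤
      (2 * n).factorial * (K / (1 - γ)) ^ n * ((1 + θ ^ 2) ^ (-γ)) ^ (2 * n) *
        (t - s) ^ (n * (2 - γ)) := by
    intro φ
    refine (hu.integral_intervalIntegral_cos_pow_le hW hWm hv hvu hγ hγ1 (2 * Real.pi * θ) φ hs hst
      ht n).trans ?_
    have h0 : 0 ≤ t - s := sub_nonneg.2 hst
    have h1 : (1 + (2 * Real.pi * θ) ^ 2) ^ (-(2 * γ)) ≤ ((1 + θ ^ 2) ^ (-γ)) ^ 2 := by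
      rw [← Real.rpow_mul_natCast (by positivity), show -γ * (2 : ℕ) = -(2 * γ) by push_cast; ring]
      refine Real.rpow_le_rpow_of_nonpos (by positivity) ?_ (by linarith)
      have h2 : (1 : ℝ) ≤ (2 * Real.pi) ^ 2 := by nlinarith [Real.pi_gt_three]
      nlinarith [sq_nonneg θ, mul_pow (2 * Real.pi) θ 2]
    have h3 : (t - s) ^ (1 - γ) * (t - s) = (t - s) ^ (2 - γ) := by
      rcases eq_or_lt_of_le h0 with h | h
      · rw [← h, Real.zero_rpow (by linarith), Real.zero_rpow (by linarith), zero_mul]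
      · conv_lhs => rw [← Real.rpow_one (t - s), ← Real.rpow_mul h.le, one_mul, ← Real.rpow_add h]
        congr 1; ring
    have h4 : (t - s) ^ (n * (2 - γ)) = ((t - s) ^ (2 - γ)) ^ n := by
      rw [← Real.rpow_mul_natCast h0, mul_comm]
    have h5 : K * (1 + (2 * Real.pi * θ) ^ 2) ^ (-(2 * γ)) * ((t - s) ^ (1 - γ) / (1 - γ)) * (t - s) ≤
        K / (1 - γ) * ((1 + θ ^ 2) ^ (-γ)) ^ 2 * (t - s) ^ (2 - γ) := by
      calc _ ≤ K * ((1 + θ ^ 2) ^ (-γ)) ^ 2 * ((t - s) ^ (1 - γ) / (1 - γ)) * (t - s) := by gcongr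
        _ = _ := by rw [← h3]; ring
    refine (mul_le_mul_of_nonneg_left (pow_le_pow_left₀ (by positivity) h5 n)
      (by positivity)).trans_eq ?_
    rw [h4, mul_pow, mul_pow, ← pow_mul]
    ring
  have henorm : ∀ ω, ‖pathFourier (v ω) s t θ‖ₑ ^ (2 * n) =
      ENNReal.ofReal (‖pathFourier (v ω) s t θ‖ ^ (2 * n)) := fun ω => by
    rw [ENNReal.ofReal_pow (norm_nonneg _), ofReal_norm]
  simp_rw [henorm]
  rw [← ofReal_integral_eq_lintegral_ofReal hmi (ae_of_all _ fun _ => by positivity)]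
  refine ENNReal.ofReal_le_ofReal ?_
  calc ∫ ω, ‖pathFourier (v ω) s t θ‖ ^ (2 * n) ∂P
      ≤ ∫ ω, 2 ^ (n - 1) * ((∫ q in s..t, Real.cos (2 * Real.pi * θ * v ω q + 0)) ^ (2 * n) +
        (∫ q in s..t, Real.cos (2 * Real.pi * θ * v ω q + Real.pi / 2)) ^ (2 * n)) ∂P := by
        refine integral_mono hmi (((hint _).add (hint _)).const_mul _) fun ω => ?_
        simp only
        rw [pow_mul, norm_pathFourier_sq (hvm ω), pow_mul _ 2 n, pow_mul _ 2 n]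
        exact add_pow_le (sq_nonneg _) (sq_nonneg _) n
    _ ≤ 2 ^ (n - 1) * ((2 * n).factorial * (K / (1 - γ)) ^ n * ((1 + θ ^ 2) ^ (-γ)) ^ (2 * n) *
        (t - s) ^ (n * (2 - γ)) + (2 * n).factorial * (K / (1 - γ)) ^ n *
          ((1 + θ ^ 2) ^ (-γ)) ^ (2 * n) * (t - s) ^ (n * (2 - γ))) := by
        rw [integral_const_mul, integral_add (hint _) (hint _)]
        gcongr
        · exact hbound 0
        · exact hbound (Real.pi / 2)
    _ = _ := by ring

lemma lintegral_one_add_sq_rpow_lt_top {γ : ℝ} (hγ : 1 / 2 < γ) :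
    ∫⁻ θ : ℝ, ENNReal.ofReal ((1 + θ ^ 2) ^ (-γ)) < ⊤ := by
  have h := integrable_rpow_neg_one_add_norm_sq (E := ℝ) (μ := volume) (r := 2 * γ)
    (by simp; linarith)
  have h2 : Integrable fun θ : ℝ => (1 + θ ^ 2) ^ (-γ) := by
    refine h.congr (ae_of_all _ fun θ => ?_)
    simp only [Real.norm_eq_abs, sq_abs]
    congr 1
    ring
  exact h2.lintegral_lt_top

/-- Moments of the increments in time of the Fourier transform of the occupation measure, in `L¹`. -/
lemma IsMildSolution.exists_lintegral_pathFourierNorm_pow_le (hW : IsWhiteNoise P W)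
    (hWm : ∀ t A, Measurable (W t A)) {u : ℝ → ℝ → Ω → ℝ} (hu : IsMildSolution P W u)
    {T x : ℝ} {v : Ω → ℝ → ℝ} (hv : Measurable (Function.uncurry v))
    (hvu : ∀ᵐ t, t ∈ Icc 0 T → (fun ω => v ω t) =ᵐ[P] u t x) {γ : ℝ} (hγ : 1 / 2 < γ) (hγ1 : γ < 1)
    {n : ℕ} (hn : n ≠ 0) :
    ∃ K : ℝ≥0∞, K ≠ ⊤ ∧ ∀ s t : ℝ, 0 ≤ s → s ≤ t → t ≤ T →
      ∫⁻ ω, pathFourierNorm (v ω) s t ^ (2 * n) ∂P ≤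
        K * ENNReal.ofReal ((t - s) ^ (n * (2 - γ))) := by
  obtain ⟨D, hD0, hD⟩ := hu.exists_lintegral_pathFourier_pow_le hW hWm hv hvu (by linarith) hγ1 n
  -- The weight matches the decay in θ of the L^(2n)(P) norm of the transform, so that after
  -- division by w^(2n-1) the 2n-th moment is again of order w, which is integrable since γ > 1/2.
  set w : ℝ → ℝ≥0∞ := fun θ => ENNReal.ofReal ((1 + θ ^ 2) ^ (-γ))
  have hwm : Measurable w := by fun_prop
  have hw0 : ∀ θ, w θ ≠ 0 := fun θ => by
    simp only [w, ne_eq, ENNReal.ofReal_eq_zero, not_le]; positivity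
  have hwt : ∀ θ, w θ ≠ ⊤ := fun θ => ENNReal.ofReal_ne_top
  have hwi : ∫⁻ θ, w θ < ⊤ := lintegral_one_add_sq_rpow_lt_top hγ
  refine ⟨(∫⁻ θ, w θ) ^ (2 * n - 1) * (ENNReal.ofReal D * ∫⁻ θ, w θ),
    ENNReal.mul_ne_top (ENNReal.pow_ne_top hwi.ne) (ENNReal.mul_ne_top ENNReal.ofReal_ne_top hwi.ne),
    ?_⟩
  intro s t hs hst ht
  have hvm : ∀ ω, Measurable (v ω) := fun ω => hv.of_uncurry_left
  have hm := measurable_pathFourier_prod hv s t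
  have hGm : Measurable fun p : Ω × ℝ =>
      ‖pathFourier (v p.1) s t p.2‖ₑ ^ (2 * n) * (w p.2)⁻¹ ^ (2 * n - 1) :=
    (hm.enorm.pow_const _).mul ((hwm.comp measurable_snd).inv.pow_const _)
  calc ∫⁻ ω, pathFourierNorm (v ω) s t ^ (2 * n) ∂P
      ≤ ∫⁻ ω, (∫⁻ θ, w θ) ^ (2 * n - 1) *
        (∫⁻ θ, ‖pathFourier (v ω) s t θ‖ₑ ^ (2 * n) * (w θ)⁻¹ ^ (2 * n - 1)) ∂P :=
        lintegral_mono fun ω => lintegral_pow_le_weighted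
          (measurable_pathFourier (hvm ω) s t).enorm.aemeasurable hwm.aemeasurable hw0 hwt (by omega)
    _ = (∫⁻ θ, w θ) ^ (2 * n - 1) *
        ∫⁻ θ, ∫⁻ ω, ‖pathFourier (v ω) s t θ‖ₑ ^ (2 * n) * (w θ)⁻¹ ^ (2 * n - 1) ∂P := by
        rw [lintegral_const_mul _ hGm.lintegral_prod_right', lintegral_lintegral_swap hGm.aemeasurable]
    _ ≤ (∫⁻ θ, w θ) ^ (2 * n - 1) *
        ∫⁻ θ, ENNReal.ofReal D * ENNReal.ofReal ((t - s) ^ (n * (2 - γ))) * w θ := by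
        gcongr with θ
        have hmθ : Measurable fun ω => pathFourier (v ω) s t θ :=
          Measurable.of_uncurry_right (f := fun ω θ => pathFourier (v ω) s t θ) hm
        rw [lintegral_mul_const _ (hmθ.enorm.pow_const _)]
        calc _ ≤ ENNReal.ofReal (D * ((1 + θ ^ 2) ^ (-γ)) ^ (2 * n) * (t - s) ^ (n * (2 - γ))) *
              (w θ)⁻¹ ^ (2 * n - 1) := by
              gcongr
              exact hD θ s t hs hst ht
          _ = ENNReal.ofReal D * ENNReal.ofReal ((t - s) ^ (n * (2 - γ))) *
              (w θ ^ (2 * n) * (w θ)⁻¹ ^ (2 * n - 1)) := by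
              rw [ENNReal.ofReal_mul (by positivity), ENNReal.ofReal_mul hD0,
                ENNReal.ofReal_pow (by positivity)]
              ring
          _ = _ := by
              congr 1
              conv_lhs => rw [show 2 * n = 2 * n - 1 + 1 by omega, pow_succ]
              rw [mul_right_comm, Nat.add_sub_cancel, ← mul_pow,
                ENNReal.mul_inv_cancel (hw0 θ) (hwt θ), one_pow, one_mul]
    _ = _ := by
        rw [lintegral_const_mul _ hwm]
        ring

end PathFourierMoments

/-! ### Changing the noise on null events -/

section Modification

variable {Ω : Type*} [MeasurableSpace Ω] {P : Measure Ω} {W W' : ℝ≥0 → BoundedBorel → Ω → ℝ}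

/-- Permits passing to a noise with measurable coordinates, for which the past really is a
sub-σ-algebra. -/
lemma IsWhiteNoise.congr (hW : IsWhiteNoise P W) (h : ∀ t A, W t A =ᵐ[P] W' t A) :
    IsWhiteNoise P W' where
  gaussian := hW.gaussian.congr fun p => h p.1 p.2
  centered t A := by
    rw [← hW.centered t A]
    exact integral_congr_ae (h t A).symm
  covariance t t' A A' := by
    rw [← hW.covariance t t' A A']
    exact integral_congr_ae ((h t A).symm.mul (h t' A').symm)

lemma stepIntegral_congr (h : ∀ t A, W t A =ᵐ[P] W' t A) {n : ℕ} (c : Fin n → ℝ)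
    (a b : Fin n → ℝ≥0) (A : Fin n → BoundedBorel) :
    stepIntegral W c a b A =ᵐ[P] stepIntegral W' c a b A := by
  have h1 := ae_all_iff.2 fun i => h (a i) (A i)
  have h2 := ae_all_iff.2 fun i => h (b i) (A i)
  filter_upwards [h1, h2] with ω h1 h2
  simp only [stepIntegral, h1, h2]

lemma IsWienerIntegral.congr (h : ∀ t A, W t A =ᵐ[P] W' t A) {f : ℝ × ℝ → ℝ} {X : Ω → ℝ}
    (hX : IsWienerIntegral P W f X) : IsWienerIntegral P W' f X := by
  refine ⟨hX.1, hX.2.1, fun ε hε => ?_⟩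
  obtain ⟨n, c, a, b, A, hab, h1, h2⟩ := hX.2.2 ε hε
  refine ⟨n, c, a, b, A, hab, h1, ?_⟩
  have h3 : (fun ω => X ω - stepIntegral W' c a b A ω) =ᵐ[P]
      fun ω => X ω - stepIntegral W c a b A ω :=
    (ae_eq_refl X).sub (stepIntegral_congr h c a b A).symm
  rwa [eLpNorm_congr_ae h3]

end Modification

/-! ### The local time as an inverse Fourier transform -/

section LocalTime

open scoped FourierTransform
open Filter Topology

/-- The inverse Fourier transform of the Fourier transform of the occupation measure on `(0, t]`. -/
noncomputable def pathLocalTime (f : ℝ → ℝ) (ξ t : ℝ) : ℝ := (𝓕⁻ (pathFourier f 0 t) ξ).re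

variable {f : ℝ → ℝ}

lemma integrable_pathFourier (hf : Measurable f) {s t : ℝ} (h : pathFourierNorm f s t < ⊤) :
    Integrable (pathFourier f s t) :=
  ⟨(measurable_pathFourier hf s t).aestronglyMeasurable, h⟩

lemma continuous_pathLocalTime (hf : Measurable f) {t : ℝ} (h : pathFourierNorm f 0 t < ⊤) :
    Continuous fun ξ => pathLocalTime f ξ t :=
  Complex.continuous_re.comp (continuous_fourierInv (integrable_pathFourier hf h))

/-- The inversion kernel has modulus one, so the L¹ norm of the increment of the transform bounds
the difference simultaneously for all ξ. -/
lemma abs_pathLocalTime_sub_le (hf : Measurable f) {s t : ℝ} (hs : pathFourierNorm f 0 s < ⊤)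
    (ht : pathFourierNorm f 0 t < ⊤) (ξ : ℝ) :
    |pathLocalTime f ξ t - pathLocalTime f ξ s| ≤ (pathFourierNorm f s t).toReal := by
  have hi : ∀ {r}, pathFourierNorm f 0 r < ⊤ →
      Integrable fun θ => Real.fourierChar (inner ℝ θ ξ) • pathFourier f 0 r θ := by
    intro r hr
    have := (Real.fourierIntegral_convergent_iff (μ := volume) (-ξ)).2 (integrable_pathFourier hf hr)
    simpa only [inner_neg_right, neg_neg] using this
  rw [pathLocalTime, pathLocalTime, ← Complex.sub_re, Real.fourierInv_eq, Real.fourierInv_eq,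
    ← integral_sub (hi ht) (hi hs)]
  refine (Complex.abs_re_le_norm _).trans ((norm_integral_le_integral_norm _).trans_eq ?_)
  rw [integral_norm_eq_lintegral_enorm (by exact ((hi ht).sub (hi hs)).aestronglyMeasurable),
    pathFourierNorm]
  congr 1
  refine lintegral_congr fun θ => ?_
  rw [← smul_sub, ← pathFourier_sub hf s t θ, ← ofReal_norm, ← ofReal_norm, Circle.norm_smul]

/-- Changing the path on a null set of times leaves the occupation measure unchanged, so a
measurable version f can stand in for g. -/
lemma isLocalTime_pathLocalTime (hf : Measurable f) {t : ℝ} (ht : 0 ≤ t)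
    (h : pathFourierNorm f 0 t < ⊤) {g : ℝ → ℝ} (hfg : g =ᵐ[volume.restrict (Icc 0 t)] f) :
    IsLocalTime g (Icc 0 t) fun ξ => pathLocalTime f ξ t := by
  have hμ : occupationMeasure g (Icc 0 t) = (volume.restrict (Icc 0 t)).map f :=
    Measure.map_congr hfg
  have hm : ∀ θ, pathFourier f 0 t θ = ∫ y, Complex.exp (-(2 * Real.pi * θ * y) * Complex.I)
      ∂((volume.restrict (Icc 0 t)).map f) := by
    intro θ
    rw [integral_map hf.aemeasurable (by fun_prop), integral_Icc_eq_integral_Ioc,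
      ← intervalIntegral.integral_of_le ht, pathFourier]
  obtain ⟨h1, h2⟩ := eq_withDensity_of_integrable_fourier hm (integrable_pathFourier hf h)
  have hd : Measurable fun ξ => ENNReal.ofReal (pathLocalTime f ξ t) :=
    (continuous_pathLocalTime hf h).measurable.ennreal_ofReal
  have h3 : occupationMeasure g (Icc 0 t) =
      volume.withDensity fun ξ => ENNReal.ofReal (pathLocalTime f ξ t) := hμ.trans h1
  refine ⟨hf.aemeasurable.congr hfg.symm, ?_, ?_⟩
  · rw [h3]
    exact withDensity_absolutelyContinuous _ _
  · rw [h3]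
    filter_upwards [Measure.rnDeriv_withDensity volume hd, h2] with ξ h4 h5
    rw [h4, ENNReal.toReal_ofReal (by exact h5)]

variable {Ω : Type*} [MeasurableSpace Ω]

lemma measurable_pathLocalTime {v : Ω → ℝ → ℝ} (hv : Measurable (Function.uncurry v)) (ξ t : ℝ) :
    Measurable fun ω => pathLocalTime (v ω) ξ t := by
  have h1 : Measurable (Function.uncurry fun ω θ =>
      Real.fourierChar (inner ℝ θ ξ) • pathFourier (v ω) 0 t θ) := by
    have h2 : Measurable fun p : Ω × ℝ => (Real.fourierChar (inner ℝ p.2 ξ) : ℂ) := by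
      have h3 : Continuous fun θ : ℝ => (Real.fourierChar (inner ℝ θ ξ) : ℂ) :=
        continuous_subtype_val.comp (Real.continuous_fourierChar.comp (by fun_prop))
      exact h3.measurable.comp measurable_snd
    exact h2.mul (measurable_pathFourier_prod hv 0 t)
  have h4 := (h1.stronglyMeasurable.integral_prod_right (ν := volume)).measurable
  have h5 : (fun ω => pathLocalTime (v ω) ξ t) = fun ω =>
      (∫ θ, Real.fourierChar (inner ℝ θ ξ) • pathFourier (v ω) 0 t θ).re := by
    ext ω
    rw [pathLocalTime, Real.fourierInv_eq]
  rw [h5]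
  exact Complex.measurable_re.comp h4

/-- Hölder continuity in time, in `L¹`, of the Fourier transform of the occupation measure of the
solution. -/
lemma IsMildSolution.exists_pathFourierNorm_le {P : Measure Ω} [IsProbabilityMeasure P]
    {W : ℝ≥0 → BoundedBorel → Ω → ℝ} (hW : IsWhiteNoise P W)
    (hWm : ∀ t A, Measurable (W t A)) {u : ℝ → ℝ → Ω → ℝ} (hu : IsMildSolution P W u)
    {T x : ℝ} (hT : 0 < T) {v : Ω → ℝ → ℝ} (hv : Measurable (Function.uncurry v))
    (hvu : ∀ᵐ t, t ∈ Icc 0 T → (fun ω => v ω t) =ᵐ[P] u t x) {α : ℝ} (hα : 1 / 2 ≤ α)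
    (hα' : α < 3 / 4) :
    ∃ C : Ω → ℝ≥0∞, Measurable C ∧ (∀ᵐ ω ∂P, C ω < ⊤) ∧ ∀ ω, ∀ s ∈ Icc 0 T, ∀ t ∈ Icc 0 T,
      pathFourierNorm (v ω) s t ≤ C ω * ENNReal.ofReal (|t - s| ^ α) := by
  -- With γ = 5/4 - α, which lies in (1/2, 3/4], Kolmogorov's condition 1 + 2nα < n(2-γ) becomes
  -- n(3/4 - α) > 1.
  obtain ⟨n, hn⟩ := exists_nat_gt (1 / (3 / 4 - α))
  have hpos : 0 < 3 / 4 - α := by linarith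
  rw [div_lt_iff₀ hpos] at hn
  have hn0 : n ≠ 0 := by
    rintro rfl
    norm_num at hn
  obtain ⟨K, hK, hmom⟩ := hu.exists_lintegral_pathFourierNorm_pow_le hW hWm hv hvu
    (γ := 5 / 4 - α) (by linarith) (by linarith) hn0
  have hvm : ∀ ω, Measurable (v ω) := fun ω => hv.of_uncurry_left
  refine exists_holder_of_moment hT (by linarith) (p := 2 * n) (by omega) ?_
    (measurable_pathFourierNorm hv) (fun ω s => pathFourierNorm_self s)
    (fun ω a b => pathFourierNorm_symm a b) (fun ω a b c => pathFourierNorm_triangle (hvm ω) a b c)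
    (fun ω s t a b ha hb => pathFourierNorm_le_liminf (hvm ω) ha hb) hK hmom
  push_cast
  nlinarith

end LocalTime

/-! ### Joint continuity and the Hölder estimate -/

theorem theorem3p2 {Ω : Type*} [MeasurableSpace Ω] (P : Measure Ω) [IsProbabilityMeasure P]
    (W : ℝ≥0 → BoundedBorel → Ω → ℝ) (hW : IsWhiteNoise P W)
    (u : ℝ → ℝ → Ω → ℝ) (hu : IsMildSolution P W u)
    (T : ℝ) (hT : 0 < T) (x : ℝ)
    (hmeas : AEMeasurable (fun p : Ω × ℝ => u p.2 x p.1)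
      (P.prod (volume.restrict (Icc (0 : ℝ) T)))) :
    ∃ L : ℝ → ℝ → Ω → ℝ,
      (∀ ξ : ℝ, ∀ t ∈ Icc (0 : ℝ) T, Measurable (L ξ t)) ∧
      (∀ᵐ ω ∂P, ∀ t ∈ Icc (0 : ℝ) T,
        IsLocalTime (fun s => u s x ω) (Icc 0 t) (fun ξ => L ξ t ω)) ∧
      (∀ᵐ ω ∂P, ContinuousOn (fun p : ℝ × ℝ => L p.1 p.2 ω)
        ((univ : Set ℝ) ×ˢ Icc (0 : ℝ) T)) ∧
      ∀ α : ℝ, α < 3 / 4 →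
        ∃ η η' : Ω → ℝ, Measurable η ∧ Measurable η' ∧
          ∀ᵐ ω ∂P, 0 < η ω ∧ 0 < η' ω ∧
            ∀ t h : ℝ, t ∈ Icc (0 : ℝ) T → t + h ∈ Icc (0 : ℝ) T → |h| < η ω →
              ∀ ξ : ℝ, |L ξ (t + h) ω - L ξ t ω| ≤ η' ω * |h| ^ α := by
  have haem : ∀ t A, AEMeasurable (W t A) P := fun t A => hW.gaussian.aemeasurable (t, A)
  have hmod : ∀ t A, W t A =ᵐ[P] (haem t A).mk (W t A) := fun t A => (haem t A).ae_eq_mk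
  have hW' : IsWhiteNoise P fun t A => (haem t A).mk (W t A) := hW.congr hmod
  have hWm : ∀ t A, Measurable ((haem t A).mk (W t A)) := fun t A => (haem t A).measurable_mk
  have hu' : IsMildSolution P (fun t A => (haem t A).mk (W t A)) u := fun t ht x =>
    (hu t ht x).congr hmod
  -- The jointly measurable version agrees with u only at almost all pairs of event and time. This
  -- is enough, because paths enter only through integrals over time.
  set v : Ω → ℝ → ℝ := fun ω t => hmeas.mk _ (ω, t)
  have hv : Measurable (Function.uncurry v) := hmeas.measurable_mk
  have hvm : ∀ ω, Measurable (v ω) := fun ω => hv.of_uncurry_left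
  have hpath : ∀ᵐ ω ∂P, (fun s => u s x ω) =ᵐ[volume.restrict (Icc 0 T)] v ω :=
    Measure.ae_ae_of_ae_prod hmeas.ae_eq_mk
  have hvu : ∀ᵐ t, t ∈ Icc 0 T → (fun ω => v ω t) =ᵐ[P] u t x := by
    rw [← ae_restrict_iff' measurableSet_Icc]
    have h1 : ∀ᵐ p ∂((volume.restrict (Icc 0 T)).prod P), u p.1 x p.2 = v p.2 p.1 :=
      Measure.measurePreserving_swap.quasiMeasurePreserving.ae hmeas.ae_eq_mk
    exact (Measure.ae_ae_of_ae_prod h1).mono fun t ht => ht.mono fun ω hω => hω.symm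
  have hsub : ∀ t ∈ Icc 0 T, ∀ s ∈ Icc 0 T, ∀ ω {α : ℝ} {C : ℝ≥0∞}, C < ⊤ →
      pathFourierNorm (v ω) s t ≤ C * ENNReal.ofReal (|t - s| ^ α) →
      pathFourierNorm (v ω) s t < ⊤ := fun _ _ _ _ _ _ _ hC h =>
    h.trans_lt (ENNReal.mul_lt_top hC ENNReal.ofReal_lt_top)
  have hzero : (0 : ℝ) ∈ Icc 0 T := ⟨le_rfl, hT.le⟩
  have hholder : ∀ {ω} {α : ℝ} {C : ℝ≥0∞}, C < ⊤ → (∀ s ∈ Icc 0 T, ∀ t ∈ Icc 0 T,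
      pathFourierNorm (v ω) s t ≤ C * ENNReal.ofReal (|t - s| ^ α)) →
      ∀ s ∈ Icc 0 T, ∀ t ∈ Icc 0 T, ∀ ξ,
        |pathLocalTime (v ω) ξ t - pathLocalTime (v ω) ξ s| ≤ C.toReal * |t - s| ^ α := by
    intro ω α C hC h s hs t ht ξ
    refine (abs_pathLocalTime_sub_le (hvm ω) (hsub s hs 0 hzero ω hC (h 0 hzero s hs))
      (hsub t ht 0 hzero ω hC (h 0 hzero t ht)) ξ).trans ?_
    refine (ENNReal.toReal_mono (ENNReal.mul_ne_top hC.ne ENNReal.ofReal_ne_top) (h s hs t ht)).trans_eq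
      ?_
    rw [ENNReal.toReal_mul, ENNReal.toReal_ofReal (by positivity)]
  -- Order 1/2 already gives finiteness of the norms and joint continuity. The local time itself is
  -- defined pathwise and does not depend on the order.
  obtain ⟨C, -, hCt, hC⟩ := hu'.exists_pathFourierNorm_le hW' hWm hT hv hvu le_rfl
    (by norm_num : (1 / 2 : ℝ) < 3 / 4)
  refine ⟨fun ξ t ω => pathLocalTime (v ω) ξ t, fun ξ t _ => measurable_pathLocalTime hv ξ t, ?_, ?_, ?_⟩
  · filter_upwards [hCt, hpath] with ω hω hp t ht
    exact isLocalTime_pathLocalTime (hvm ω) ht.1 (hsub t ht 0 hzero ω hω (hC ω 0 hzero t ht))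
      (ae_mono (Measure.restrict_mono (Icc_subset_Icc_right ht.2) le_rfl) hp)
  · filter_upwards [hCt] with ω hω
    rintro ⟨ξ, t⟩ ⟨-, ht⟩
    -- Joint continuity combines continuity in ξ at the fixed time t with a time increment that is
    -- small uniformly in ξ.
    have h1 : Filter.Tendsto (fun p : ℝ × ℝ => pathLocalTime (v ω) p.1 t)
        (nhdsWithin (ξ, t) (univ ×ˢ Icc 0 T)) (nhds (pathLocalTime (v ω) ξ t)) :=
      (((continuous_pathLocalTime (hvm ω) (hsub t ht 0 hzero ω hω (hC ω 0 hzero t ht))).comp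
        continuous_fst).tendsto (ξ, t)).mono_left nhdsWithin_le_nhds
    have h2 : Filter.Tendsto (fun p : ℝ × ℝ => (C ω).toReal * |p.2 - t| ^ (1 / 2 : ℝ))
        (nhdsWithin (ξ, t) (univ ×ˢ Icc 0 T)) (nhds 0) := by
      have hc : Continuous fun p : ℝ × ℝ => (C ω).toReal * |p.2 - t| ^ (1 / 2 : ℝ) := by
        have : Continuous fun p : ℝ × ℝ => |p.2 - t| := by fun_prop
        exact (this.rpow_const fun _ => Or.inr (by norm_num)).const_mul _
      have := (hc.tendsto (ξ, t)).mono_left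
        (nhdsWithin_le_nhds (s := (univ : Set ℝ) ×ˢ Icc (0 : ℝ) T))
      simpa using this
    have h3 : Filter.Tendsto
        (fun p : ℝ × ℝ => pathLocalTime (v ω) p.1 p.2 - pathLocalTime (v ω) p.1 t)
        (nhdsWithin (ξ, t) (univ ×ˢ Icc 0 T)) (nhds 0) := by
      refine squeeze_zero_norm' ?_ h2
      filter_upwards [self_mem_nhdsWithin] with p hp
      exact hholder hω (hC ω) t ht p.2 hp.2 p.1
    have h4 := h1.add h3
    rw [add_zero] at h4
    exact h4.congr fun p => by ring
  · intro α hα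
    -- Orders below 1/2, including negative ones, are reduced to 1/2: for |h| < 1 a larger exponent
    -- gives a smaller power, hence the choice η = 1. The added 1 in η' ensures positivity.
    obtain ⟨D, hDm, hDt, hD⟩ := hu'.exists_pathFourierNorm_le hW' hWm hT hv hvu
      (le_max_right α (1 / 2)) (max_lt hα (by norm_num))
    refine ⟨fun _ => 1, fun ω => (D ω).toReal + 1, measurable_const,
      hDm.ennreal_toReal.add_const 1, ?_⟩
    filter_upwards [hDt] with ω hω
    refine ⟨one_pos, by positivity, fun t h ht hth hh ξ => ?_⟩
    rcases eq_or_ne h 0 with rfl | h0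
    · rw [add_zero, sub_self, abs_zero]
      positivity
    · have h1 := hholder hω (hD ω) t ht (t + h) hth ξ
      rw [add_sub_cancel_left] at h1
      refine h1.trans (mul_le_mul (by linarith) ?_ (by positivity) (by positivity))
      exact Real.rpow_le_rpow_of_exponent_ge (abs_pos.2 h0) hh.le (le_max_left _ _)
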